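/- Let $G$ be a finite simple graph on $n$ vertices that contains neither a triangle $C_3$ nor a $5$-cycle $C_5$ as a (not necessarily induced) subgraph, and suppose that every vertex of $G$ has degree greater than $n/5$, i.e. $\delta(G) > n/5$ (where $n\ge 1$). Then there is an integer $k \ge 1$ such that $G$ is homomorphic to $F_k$, that is, there is a map $f : V(G) \to V(F_k)$ with $f(u)f(v) \in E(F_k)$ whenever $uv \in E(G)$. Here, for $k \ge 1$, $F_k$ is the graph obtained from a cycle of length $5k-3$ (a single edge when $k=1$) by adding all chords joining two vertices whose distance along the cycle is congruent to $1$ modulo $5$. -/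

import Mathlib

/-- Distance along the `N`-cycle with vertices `0, 1, …, N - 1` in cyclic order: the length of the
shorter of the two arcs between `i` and `j`. -/
def cyclicDist {N : ℕ} (i j : Fin N) : ℕ :=
  min (Nat.dist i j) (N - Nat.dist i j)

/-- The generalised Andrásfai graph `F_k` (for `k ≥ 1`): vertices of a `(5k - 3)`-cycle (an edge
when `k = 1`), two vertices being adjacent when their distance along the cycle is congruent to `1`
modulo `5`. Distance `1` gives the edges of the cycle itself. -/
def andrasfaiF (k : ℕ) : SimpleGraph (Fin (5 * k - 3)) where
  Adj i j := cyclicDist i j ≡ 1 [MOD 5]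
  symm := ⟨fun i j h => by
    simpa only [cyclicDist, Nat.dist_comm] using h⟩
  loopless := ⟨fun i h => by
    simp [cyclicDist, Nat.ModEq] at h⟩

/-! Enlarge the graph to an edge-maximal one without closed 5-walks. Non-adjacent vertices are then
joined by walks of length four. Short local configurations are excluded by finite certificates
(`check_sound`) built on one double count: when all degrees exceed `n/5`, no points of total weight
at least `5m > 0` can have at most weight `m` in every neighbourhood. The first consequence is
`hexagonChord`.

If there is no closed 7-walk, saturation makes the graph bipartite (`exists_isHeptagon_of_odd`) and
`k = 1` serves. Otherwise fix a heptagon. Every vertex has a neighbour on it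
(`exists_adj_heptagon`), in fact one or two consecutive ones. This places the vertices on a circle
of fourteen points with edges joining nearly opposite points (`exists_placement`). Writing each edge
as an odd number of half-turns plus a small deviation gives odd antisymmetric edge weights, whose
sum `M` round a closed walk is a winding number.

The key inequality is `5 * M < ℓ` for closed walks of length `ℓ`. It is direct for `ℓ < 10`
(`closed_walk_small`), and density extends it to all lengths (`winding_lt`). It rules out negative
cycles for a suitable edge cost, and the shortest-path potential (`exists_potential`), multiplied by
five and reduced modulo `5n + 2`, is the homomorphism to `F_{n+1}`. -/

/-- There is no closed walk of length five; equivalently, `G` has odd girth at least seven. -/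
def NoClosedFiveWalk {V : Type*} (G : SimpleGraph V) : Prop :=
  ∀ a b c d e, G.Adj a b → G.Adj b c → G.Adj c d → G.Adj d e → ¬ G.Adj e a

open Classical in
/-- Every vertex has more than `|V| / 5` neighbours. -/
def DenseFifth {V : Type*} [Fintype V] (G : SimpleGraph V) : Prop :=
  ∀ v, Fintype.card V < 5 * (Finset.univ.filter (G.Adj v)).card

/-- Every closed walk of length six has a chord joining antipodal vertices. -/
def HexagonChord {V : Type*} (G : SimpleGraph V) : Prop :=
  ∀ a b c d e f, G.Adj a b → G.Adj b c → G.Adj c d → G.Adj d e → G.Adj e f → G.Adj f a →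
    G.Adj a d ∨ G.Adj b e ∨ G.Adj c f

/-- `y` traverses a closed walk of length seven, indexed by the cyclic order of its vertices in
which each vertex is joined to the two nearly opposite ones. -/
def IsHeptagon {V : Type*} (G : SimpleGraph V) (y : ZMod 7 → V) : Prop :=
  ∀ j, G.Adj (y j) (y (j + 3))

/-- Two vertices have a common neighbour. -/
def Close {V : Type*} (G : SimpleGraph V) (u v : V) : Prop :=
  ∃ w, G.Adj w u ∧ G.Adj w v

/-- Closeness to vertices of a heptagon at distance two passes to the vertex between them. -/
def HeptagonConvex {V : Type*} (G : SimpleGraph V) : Prop :=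
  ∀ (y : ZMod 7 → V) (v : V), IsHeptagon G y → Close G v (y 0) → Close G v (y 2) →
    Close G v (y 1)

/-! ### Certificates refuting finite configurations -/

namespace Refutation

/-- Certificates that a finite configuration of vertices, adjacencies and sets without common
neighbour does not occur. -/
inductive Cert
  | pack (w : List (ℕ × ℕ)) (m : ℕ)
  | walk (x : ℕ)
  | nog (x : ℕ)
  | split (p : List ℕ) (no yes : Cert)
  | hex (a b c d e f : ℕ) (ad be cf : Cert)
  | gap (y : List ℕ) (v n m : ℕ) (next : Cert)

/-- The vertices adjacent to a member of the set `m`, sets being encoded in binary. -/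
def step (E : List (ℕ × ℕ)) (m : ℕ) : ℕ :=
  E.foldr (fun e r =>
    (if m.testBit e.1 then 2 ^ e.2 else 0) ||| ((if m.testBit e.2 then 2 ^ e.1 else 0) ||| r)) 0

def edge (E : List (ℕ × ℕ)) (i j : ℕ) : Bool :=
  E.any fun e => (e.1 == i && e.2 == j) || (e.1 == j && e.2 == i)

/-- A point of a packing with its weight, the points three steps away, and the relevant sets
without common neighbour. -/
def point (E : List (ℕ × ℕ)) (N : List (List ℕ)) (x : ℕ × ℕ) : ℕ × ℕ × ℕ × List (List ℕ) :=
  (x.1, x.2, step E (step E (step E (2 ^ x.1))), N.filter fun p => p.contains x.1)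

/-- `c` encodes the points three steps from `x`; a common neighbour of `x` and such a point would
lie on a closed 5-walk. -/
def bad (x c : ℕ) (N : List (List ℕ)) (S : ℕ) : Bool :=
  (c &&& S != 0) || N.any fun p => p.all fun i => i == x || S.testBit i

/-- An upper bound for the weight of the points adjacent to a vertex. -/
def best : List (ℕ × ℕ × ℕ × List (List ℕ)) → ℕ → ℕ
  | [], _ => 0
  | (x, w, c, N) :: l, S =>
    if bad x c N S then best l S else max (best l S) (w + best l (S ||| 2 ^ x))

def below (n : ℕ) (E : List (ℕ × ℕ)) (N : List (List ℕ)) : Bool :=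
  (E.all fun e => decide (e.1 < n) && decide (e.2 < n)) &&
    N.all fun p => p.all fun i => decide (i < n)

/-- `hx` and `gp` say whether the hexagon and convexity rules may be used; the natural number is the
next fresh vertex name. Names need not denote distinct vertices, so only walks matter. `pack` is the
double count, `split` decides whether a set has a common neighbour, `walk` and `nog` are the
immediate contradictions. -/
def check (hx gp : Bool) : Cert → ℕ → List (ℕ × ℕ) → List (List ℕ) → Bool
  | .pack w m, _, E, N =>
    decide (0 < m) && decide (5 * m ≤ (w.map Prod.snd).sum) &&
      decide (best (w.map (point E N)) 0 ≤ m)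
  | .walk x, _, E, _ => (step E (step E (step E (step E (step E (2 ^ x)))))).testBit x
  | .nog x, _, E, N => N.any fun p => p.all fun i => edge E x i
  | .split p no yes, n, E, N =>
    check hx gp no n E (p :: N) && below n E N && (p.all fun i => decide (i < n)) &&
      check hx gp yes (n + 1) (p.map (fun i => (n, i)) ++ E) N
  | .hex a b c d e f ad be cf, n, E, N =>
    hx && edge E a b && edge E b c && edge E c d && edge E d e && edge E e f && edge E f a &&
      check hx gp ad n ((a, d) :: E) N && check hx gp be n ((b, e) :: E) N &&
      check hx gp cf n ((c, f) :: E) N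
  | .gap y v i j next, n, E, N =>
    gp && ((List.range 7).all fun t => edge E (y.getD t 0) (y.getD ((t + 3) % 7) 0)) &&
      edge E i v && edge E i (y.getD 0 0) && edge E j v && edge E j (y.getD 2 0) && below n E N &&
      decide (v < n) && decide (y.getD 1 0 < n) &&
      check hx gp next (n + 1) ((n, v) :: (n, y.getD 1 0) :: E) N

section soundness

variable {V : Type*} {G : SimpleGraph V}

/-- The configuration is realised by the vertices `ρ 0, ρ 1, …`. -/
structure Realizes (G : SimpleGraph V) (ρ : ℕ → V) (E : List (ℕ × ℕ)) (N : List (List ℕ)) :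
    Prop where
  adj : ∀ e ∈ E, G.Adj (ρ e.1) (ρ e.2)
  nog : ∀ p ∈ N, ∀ v, ¬ ∀ i ∈ p, G.Adj v (ρ i)

variable {ρ : ℕ → V} {E : List (ℕ × ℕ)} {N : List (List ℕ)}

theorem adj_of_edge (hE : ∀ e ∈ E, G.Adj (ρ e.1) (ρ e.2)) {i j : ℕ} (h : edge E i j = true) :
    G.Adj (ρ i) (ρ j) := by
  simp only [edge, List.any_eq_true, Bool.or_eq_true, Bool.and_eq_true, beq_iff_eq] at h
  obtain ⟨e, he, ⟨rfl, rfl⟩ | ⟨rfl, rfl⟩⟩ := h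
  · exact hE e he
  · exact (hE e he).symm

theorem adj_of_step (hE : ∀ e ∈ E, G.Adj (ρ e.1) (ρ e.2)) {m j : ℕ}
    (h : (step E m).testBit j = true) : ∃ i, m.testBit i = true ∧ G.Adj (ρ i) (ρ j) := by
  induction E with
  | nil => simp [step] at h
  | cons e E ih =>
    have hstep : step (e :: E) m = (if m.testBit e.1 then 2 ^ e.2 else 0) |||
      ((if m.testBit e.2 then 2 ^ e.1 else 0) ||| step E m) := rfl
    rw [hstep, Nat.testBit_or, Nat.testBit_or, Bool.or_eq_true, Bool.or_eq_true] at h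
    have he := hE e (by simp)
    rcases h with h | h | h
    · split_ifs at h with hm
      · rw [Nat.testBit_two_pow, decide_eq_true_eq] at h
        subst h
        exact ⟨_, hm, he⟩
      · simp at h
    · split_ifs at h with hm
      · rw [Nat.testBit_two_pow, decide_eq_true_eq] at h
        subst h
        exact ⟨_, hm, he.symm⟩
      · simp at h
    · exact ih (fun e' he' => hE e' (by simp [he'])) h

theorem eq_of_testBit_two_pow {x i : ℕ} (h : (2 ^ x).testBit i = true) : i = x := by
  rw [Nat.testBit_two_pow, decide_eq_true_eq] at h
  exact h.symm

-- `S` collects the listed neighbours of `v` met so far. A point flagged by `bad` cannot join them,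
-- so the branch really followed by `v` is among those maximised in `best`.
open Classical in
theorem sum_le_best (h5 : NoClosedFiveWalk G) (h : Realizes G ρ E N) (v : V)
    (l : List (ℕ × ℕ)) : ∀ S : ℕ, (∀ i, S.testBit i = true → G.Adj v (ρ i)) →
      (l.map fun x => if G.Adj v (ρ x.1) then x.2 else 0).sum ≤ best (l.map (point E N)) S := by
  induction l with
  | nil => simp [best]
  | cons x l ih =>
    intro S hS
    obtain ⟨x, w⟩ := x
    simp only [List.map_cons, List.sum_cons, point, best]
    by_cases hx : G.Adj v (ρ x)
    · have hb : bad x (step E (step E (step E (2 ^ x))))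
          (N.filter fun p => p.contains x) S = false := by
        rw [Bool.eq_false_iff]
        intro hb
        rw [bad, Bool.or_eq_true] at hb
        rcases hb with hb | hb
        · have hne : step E (step E (step E (2 ^ x))) &&& S ≠ 0 := by simpa using hb
          obtain ⟨i, hi⟩ := Nat.exists_testBit_of_ne_zero hne
          rw [Nat.testBit_and, Bool.and_eq_true] at hi
          obtain ⟨a, ha, hai⟩ := adj_of_step h.adj hi.1
          obtain ⟨b, hb, hba⟩ := adj_of_step h.adj ha
          obtain ⟨c, hc, hcb⟩ := adj_of_step h.adj hb
          rw [eq_of_testBit_two_pow hc] at hcb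
          exact h5 _ _ _ _ _ hx hcb hba hai (hS i hi.2).symm
        · simp only [List.any_eq_true, List.mem_filter, List.all_eq_true, Bool.or_eq_true,
            beq_iff_eq] at hb
          obtain ⟨p, ⟨hp, -⟩, hall⟩ := hb
          refine h.nog p hp v fun i hi => ?_
          rcases hall i hi with rfl | h'
          · exact hx
          · exact hS i h'
      rw [if_pos hx, hb, if_neg Bool.false_ne_true]
      refine le_trans ?_ (le_max_right _ _)
      refine Nat.add_le_add_left (ih _ fun i hi => ?_) _
      rw [Nat.testBit_or, Bool.or_eq_true] at hi
      rcases hi with hi | hi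
      · exact hS i hi
      · rwa [eq_of_testBit_two_pow hi]
    · rw [if_neg hx, zero_add]
      refine (ih S hS).trans ?_
      split_ifs
      · exact le_rfl
      · exact le_max_left _ _

/-- Count weighted adjacencies between the listed points and all vertices: the degrees make the
total exceed `m * |V|`, while each vertex contributes at most `m`. -/
theorem pack_false [Fintype V] (h5 : NoClosedFiveWalk G) (hd : DenseFifth G)
    (h : Realizes G ρ E N) (w : List (ℕ × ℕ)) (m : ℕ) (hm : 0 < m)
    (hw : 5 * m ≤ (w.map Prod.snd).sum) (hb : best (w.map (point E N)) 0 ≤ m) : False := by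
  classical
  have hle : ∀ v, (w.map fun x => if G.Adj v (ρ x.1) then x.2 else 0).sum ≤ m := fun v =>
    (sum_le_best h5 h v w 0 (by simp)).trans hb
  -- The `+ 1` keeps the strictness of the degree bound.
  have hcount : ∀ l : List (ℕ × ℕ), (l.map Prod.snd).sum * (Fintype.card V + 1) ≤
      5 * ∑ v, (l.map fun x => if G.Adj v (ρ x.1) then x.2 else 0).sum := by
    intro l
    induction l with
    | nil => simp
    | cons x l ih =>
      have hx : ∑ v, (if G.Adj v (ρ x.1) then x.2 else 0) =
          x.2 * (Finset.univ.filter (G.Adj (ρ x.1))).card := by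
        rw [← Finset.sum_filter, Finset.sum_const, smul_eq_mul, mul_comm]
        congr 3
        ext v
        simp [G.adj_comm]
      simp only [List.map_cons, List.sum_cons, Finset.sum_add_distrib, mul_add, add_mul (x.2)]
      rw [hx]
      have h1 := Nat.mul_le_mul_left x.2 (Nat.succ_le_of_lt (hd (ρ x.1)))
      have h2 : x.2 * (5 * (Finset.univ.filter (G.Adj (ρ x.1))).card) =
          5 * (x.2 * (Finset.univ.filter (G.Adj (ρ x.1))).card) := by ring
      have h3 : x.2 * (Fintype.card V).succ = x.2 * Fintype.card V + x.2 := Nat.mul_succ _ _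
      rw [mul_add] at ih
      linarith
  have h1 := hcount w
  have h2 : ∑ v, (w.map fun x => if G.Adj v (ρ x.1) then x.2 else 0).sum ≤ Fintype.card V * m := by
    simpa using Finset.sum_le_card_nsmul Finset.univ _ m fun v _ => hle v
  have h3 := Nat.mul_le_mul_right (Fintype.card V + 1) hw
  nlinarith

theorem Realizes.extend {n : ℕ} (h : Realizes G ρ E N) (hb : below n E N = true) (v : V)
    (p : List ℕ) (hp : ∀ i ∈ p, i < n) (hv : ∀ i ∈ p, G.Adj v (ρ i)) :
    Realizes G (Function.update ρ n v) (p.map (fun i => (n, i)) ++ E) N := by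
  simp only [below, Bool.and_eq_true, List.all_eq_true, decide_eq_true_eq] at hb
  refine ⟨fun e he => ?_, fun q hq u hu => h.nog q hq u fun i hi => ?_⟩
  · rw [List.mem_append, List.mem_map] at he
    rcases he with ⟨i, hi, rfl⟩ | he
    · simpa [Function.update_of_ne (hp i hi).ne] using hv i hi
    · have := hb.1 e he
      simpa [Function.update_of_ne this.1.ne, Function.update_of_ne this.2.ne] using h.adj e he
  · have := hu i hi
    rwa [Function.update_of_ne (hb.2 q hq i hi).ne] at this

theorem Realizes.addEdge (h : Realizes G ρ E N) {i j : ℕ} (hij : G.Adj (ρ i) (ρ j)) :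
    Realizes G ρ ((i, j) :: E) N :=
  ⟨fun e he => by
    rcases List.mem_cons.1 he with rfl | he
    · exact hij
    · exact h.adj e he, h.nog⟩

/-- A checked certificate refutes every realisation. -/
theorem check_sound [Fintype V] (h5 : NoClosedFiveWalk G) (hd : DenseFifth G) {hx gp : Bool}
    (hhex : hx = true → HexagonChord G) (hgap : gp = true → HeptagonConvex G) (t : Cert) :
    ∀ {n : ℕ} {ρ : ℕ → V} {E : List (ℕ × ℕ)} {N : List (List ℕ)}, check hx gp t n E N = true →
      Realizes G ρ E N → False := by
  induction t with
  | pack w m =>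
    intro n ρ E N hc h
    simp only [check, Bool.and_eq_true, decide_eq_true_eq] at hc
    exact pack_false h5 hd h w m hc.1.1 hc.1.2 hc.2
  | walk x =>
    intro n ρ E N hc h
    obtain ⟨a, ha, hax⟩ := adj_of_step h.adj hc
    obtain ⟨b, hb, hba⟩ := adj_of_step h.adj ha
    obtain ⟨c, hc, hcb⟩ := adj_of_step h.adj hb
    obtain ⟨d, hd, hdc⟩ := adj_of_step h.adj hc
    obtain ⟨e, he, hed⟩ := adj_of_step h.adj hd
    rw [eq_of_testBit_two_pow he] at hed
    exact h5 _ _ _ _ _ hed hdc hcb hba hax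
  | nog x =>
    intro n ρ E N hc h
    simp only [check, List.any_eq_true, List.all_eq_true] at hc
    obtain ⟨p, hp, hall⟩ := hc
    exact h.nog p hp (ρ x) fun i hi => adj_of_edge h.adj (hall i hi)
  | split p no yes ihno ihyes =>
    intro n ρ E N hc h
    simp only [check, Bool.and_eq_true, List.all_eq_true, decide_eq_true_eq] at hc
    obtain ⟨⟨⟨hno, hb⟩, hp⟩, hyes⟩ := hc
    by_cases hv : ∃ v, ∀ i ∈ p, G.Adj v (ρ i)
    · obtain ⟨v, hv⟩ := hv
      exact ihyes hyes (h.extend hb v p hp hv)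
    · refine ihno hno ⟨h.adj, fun q hq => ?_⟩
      rcases List.mem_cons.1 hq with rfl | hq
      · exact not_exists.1 hv
      · exact h.nog q hq
  | hex a b c d e f ad be cf ihad ihbe ihcf =>
    intro n ρ E N hc h
    simp only [check, Bool.and_eq_true] at hc
    obtain ⟨⟨⟨⟨⟨⟨⟨⟨⟨hhx, h1⟩, h2⟩, h3⟩, h4⟩, h5'⟩, h6⟩, had⟩, hbe⟩, hcf⟩ := hc
    rcases hhex hhx _ _ _ _ _ _ (adj_of_edge h.adj h1) (adj_of_edge h.adj h2)
      (adj_of_edge h.adj h3) (adj_of_edge h.adj h4) (adj_of_edge h.adj h5')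
      (adj_of_edge h.adj h6) with h' | h' | h'
    · exact ihad had (h.addEdge h')
    · exact ihbe hbe (h.addEdge h')
    · exact ihcf hcf (h.addEdge h')
  | gap y v i j next ih =>
    intro n ρ E N hc h
    simp only [check, Bool.and_eq_true, List.all_eq_true, decide_eq_true_eq, List.mem_range] at hc
    obtain ⟨⟨⟨⟨⟨⟨⟨⟨⟨hgp, hy⟩, h1⟩, h2⟩, h3⟩, h4⟩, hb⟩, hv⟩, hy1⟩, hnext⟩ := hc
    obtain ⟨w, hwv, hwy⟩ := hgap hgp (fun t : ZMod 7 => ρ (y.getD t.val 0)) (ρ v)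
      (fun t => by
        have hval : (t + 3).val = (t.val + 3) % 7 := ZMod.val_add t 3
        have := adj_of_edge h.adj (hy t.val (ZMod.val_lt t))
        rwa [← hval] at this)
      ⟨ρ i, adj_of_edge h.adj h1, adj_of_edge h.adj h2⟩
      ⟨ρ j, adj_of_edge h.adj h3, adj_of_edge h.adj h4⟩
    refine ih hnext (h.extend hb w [v, y.getD 1 0] (by simpa using ⟨hv, hy1⟩) ?_)
    intro k hk
    rcases List.mem_pair.1 hk with rfl | rfl
    · exact hwv
    · exact hwy

end soundness

end Refutation

/-! ### Saturation and the certificates -/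

/-- There is a walk of length four from `u` to `v`. -/
def FourWalk {V : Type*} (G : SimpleGraph V) (u v : V) : Prop :=
  ∃ a b c, G.Adj u a ∧ G.Adj a b ∧ G.Adj b c ∧ G.Adj c v

/-- Non-adjacent vertices are joined by a walk of length four. -/
def FourWalkSaturated {V : Type*} (G : SimpleGraph V) : Prop :=
  ∀ u v, ¬ G.Adj u v → FourWalk G u v

namespace Refutation

/-- The edges of a heptagon occupying the positions `1, …, 7`. -/
def heptagonEdges : List (ℕ × ℕ) := [(1, 4), (2, 5), (3, 6), (4, 7), (5, 1), (6, 2), (7, 3)]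

/-- A hexagon none of whose antipodal pairs is adjacent. -/
def hexagonCert : Cert :=
  .split [8, 14] (.split [7, 10] (.split [8, 9] (.split [7, 13] (.split [6, 12] (.split [6, 11]
  (.split [10, 13] (.split [11, 12] (.split [9, 14] (.pack [(0, 1), (1, 1), (2, 1), (3, 1), (4,
  1), (5, 1), (6, 1), (7, 1), (8, 1), (9, 1), (10, 1), (11, 1), (12, 1), (13, 1), (14, 1)] 3)
  (.pack [(2, 1), (3, 1), (4, 1), (9, 1), (10, 1), (11, 1), (12, 1), (13, 1), (14, 1), (15, 1)]
  2)) (.split [9, 14] (.pack [(0, 1), (1, 1), (5, 1), (9, 1), (10, 1), (11, 1), (12, 1), (13,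
  1), (14, 1), (15, 1)] 2) (.pack [(1, 1), (2, 1), (4, 1), (5, 1), (9, 1), (10, 1), (11, 1),
  (12, 1), (13, 1), (14, 1)] 2))) (.pack [(1, 1), (2, 1), (4, 1), (5, 1), (9, 1), (10, 1), (11,
  1), (12, 1), (13, 1), (14, 1)] 2)) (.pack [(1, 1), (2, 1), (3, 1), (6, 1), (7, 1), (8, 1), (9,
  1), (10, 1), (11, 1), (15, 1)] 2)) (.pack [(3, 1), (4, 1), (5, 1), (6, 1), (7, 1), (8, 1),
  (12, 1), (13, 1), (14, 1), (15, 1)] 2)) (.pack [(0, 1), (2, 1), (3, 1), (5, 1), (6, 1), (7,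
  1), (8, 1), (12, 1), (13, 1), (14, 1)] 2)) (.split [6, 11] (.pack [(0, 1), (4, 1), (5, 1), (6,
  1), (7, 1), (8, 1), (9, 1), (10, 1), (11, 1), (15, 1)] 2) (.pack [(0, 1), (1, 1), (3, 1), (4,
  1), (6, 1), (7, 1), (8, 1), (9, 1), (10, 1), (11, 1)] 2))) (.pack [(0, 1), (1, 1), (3, 1), (4,
  1), (6, 1), (7, 1), (8, 1), (9, 1), (10, 1), (11, 1)] 2)) (.split [7, 13] (.split [6, 12]
  (.pack [(0, 1), (1, 1), (2, 1), (6, 1), (7, 1), (8, 1), (12, 1), (13, 1), (14, 1), (15, 1)] 2)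
  (.pack [(0, 1), (2, 1), (3, 1), (5, 1), (6, 1), (7, 1), (8, 1), (12, 1), (13, 1), (14, 1)] 2))
  (.pack [(0, 1), (2, 1), (3, 1), (5, 1), (6, 1), (7, 1), (8, 1), (12, 1), (13, 1), (14, 1)] 2))

/-- A vertex close to the heptagon vertices `0`, `2`, not to `1`, and with walks of length four to
`4`, `5`. -/
def convexCert : Cert :=
  .split [4, 14] (.split [6, 10] (.split [4, 10] (.split [2, 10] (.pack [(0, 1), (2, 1), (4, 1),
  (6, 1), (10, 1)] 1) (.split [7, 16] (.pack [(0, 1), (1, 1), (2, 1), (3, 1), (4, 1), (6, 1),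
  (7, 1), (8, 1), (10, 1), (16, 1)] 2) (.pack [(0, 1), (1, 1), (2, 1), (3, 1), (4, 1), (5, 1),
  (7, 1), (9, 1), (10, 1), (16, 1)] 2))) (.split [2, 10] (.pack [(0, 1), (2, 1), (5, 1), (7, 1),
  (10, 1)] 1) (.pack [(0, 1), (1, 1), (2, 1), (3, 1), (4, 1), (5, 1), (7, 1), (9, 1), (10, 1),
  (17, 1)] 2))) (.split [1, 14] (.split [5, 13] (.split [7, 13] (.pack [(0, 1), (1, 1), (2, 1),
  (3, 1), (4, 1), (5, 1), (7, 1), (9, 1), (13, 1), (14, 1)] 2) (.pack [(0, 1), (1, 1), (2, 1),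
  (3, 1), (4, 1), (6, 1), (7, 1), (8, 1), (13, 1), (14, 1)] 2)) (.pack [(1, 1), (3, 1), (5, 1),
  (10, 1), (14, 1)] 1)) (.split [12, 14] (.split [11, 15] (.hex 0 8 1 17 14 13 (.pack [(1, 1),
  (5, 1), (6, 1), (10, 1), (11, 1), (12, 1), (14, 1), (15, 1), (16, 1), (17, 1)] 2) (.pack [(1,
  1), (5, 1), (6, 1), (8, 1), (10, 1), (11, 1), (12, 1), (14, 1), (15, 1), (16, 1)] 2) (.pack
  [(1, 1), (5, 1), (6, 1), (10, 1), (11, 1), (12, 1), (13, 1), (14, 1), (15, 1), (16, 1)] 2))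
  (.hex 0 8 1 17 14 13 (.pack [(0, 1), (2, 1), (5, 1), (6, 1), (10, 1), (11, 1), (12, 1), (14,
  1), (15, 1), (17, 1)] 2) (.pack [(0, 1), (2, 1), (5, 1), (6, 1), (8, 1), (10, 1), (11, 1),
  (12, 1), (14, 1), (15, 1)] 2) (.pack [(0, 1), (2, 1), (5, 1), (6, 1), (10, 1), (11, 1), (12,
  1), (13, 1), (14, 1), (15, 1)] 2))) (.hex 0 8 1 17 14 13 (.pack [(0, 1), (2, 1), (5, 1), (6,
  1), (10, 1), (11, 1), (12, 1), (14, 1), (15, 1), (17, 1)] 2) (.pack [(0, 1), (2, 1), (5, 1),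
  (6, 1), (8, 1), (10, 1), (11, 1), (12, 1), (14, 1), (15, 1)] 2) (.pack [(0, 1), (2, 1), (5,
  1), (6, 1), (10, 1), (11, 1), (12, 1), (13, 1), (14, 1), (15, 1)] 2))))) (.pack [(0, 1), (1,
  1), (2, 1), (3, 1), (4, 1), (6, 1), (7, 1), (8, 1), (13, 1), (14, 1)] 2)

/-- A vertex sharing one neighbour with the heptagon vertices `0`, `1`, not close to `2`, `6`, and
with a walk of length four to `4`. -/
def nextCert : Cert :=
  .split [3, 9] (.split [7, 9] (.pack [(0, 1), (3, 1), (5, 1), (7, 1), (9, 1)] 1) (.gap [8, 6,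
  7, 1, 2, 3, 4] 9 0 12 (.hex 0 8 2 6 13 9 (.nog 6) (.hex 3 7 12 9 13 6 (.nog 9) (.walk 1) (.hex
  0 8 2 6 12 9 (.nog 6) (.walk 1) (.walk 2))) (.walk 2)))) (.gap [3, 4, 8, 6, 7, 1, 2] 9 12 0
  (.hex 0 8 1 4 13 9 (.nog 4) (.hex 3 7 4 13 9 12 (.walk 2) (.nog 9) (.hex 0 8 1 4 12 9 (.nog 4)
  (.walk 2) (.walk 1))) (.walk 1)))

/-- A neighbour of a vertex far from the heptagon that is close to `0` but not to `1`, `6`. -/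
def isolatedCert : Cert :=
  .pack [(0, 2), (1, 1), (2, 1), (3, 1), (4, 1), (5, 1), (6, 1), (7, 1), (8, 1)] 2

/-- A neighbour of a vertex far from the heptagon that is close to `0`, `1` but not to `2`, `6`. -/
def isolatedPairCert : Cert :=
  .pack [(0, 1), (3, 1), (5, 1), (7, 1), (8, 1)] 1

/-- A vertex far from the heptagon with a walk of length four to `0` and a neighbour close to `0`,
`1`, `6`. -/
def farCert : Cert :=
  .split [2, 12] (.split [3, 12] (.split [4, 12] (.split [5, 12] (.pack [(0, 1), (1, 1), (3, 1),
  (5, 1), (12, 1)] 1) (.split [6, 12] (.pack [(0, 2), (1, 1), (2, 1), (3, 1), (4, 1), (5, 1),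
  (6, 1), (7, 1), (12, 1)] 2) (.split [7, 12] (.pack [(0, 1), (2, 1), (4, 1), (7, 1), (12, 1)]
  1) (.hex 1 5 2 10 8 9 (.hex 1 4 7 11 8 10 (.hex 0 8 11 7 17 12 (.nog 7) (.hex 4 1 10 8 17 7
  (.nog 8) (.walk 1) (.walk 2)) (.walk 1)) (.nog 8) (.walk 2)) (.walk 0) (.hex 1 4 7 11 8 9
  (.hex 0 8 11 7 17 12 (.nog 7) (.hex 4 1 9 8 17 7 (.nog 8) (.walk 1) (.walk 2)) (.walk 1))
  (.nog 8) (.walk 2)))))) (.split [6, 12] (.pack [(0, 1), (1, 1), (3, 1), (6, 1), (12, 1)] 1)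
  (.hex 1 5 2 10 8 9 (.pack [(0, 1), (2, 1), (3, 1), (4, 1), (6, 1), (7, 1), (8, 1), (10, 1),
  (12, 1), (15, 1)] 2) (.nog 8) (.pack [(0, 1), (2, 1), (3, 1), (4, 1), (6, 1), (7, 1), (8, 1),
  (9, 1), (12, 1), (15, 1)] 2)))) (.split [5, 12] (.pack [(0, 1), (2, 1), (5, 1), (7, 1), (12,
  1)] 1) (.hex 1 4 7 11 8 9 (.pack [(0, 1), (2, 1), (3, 1), (5, 1), (6, 1), (7, 1), (8, 1), (11,
  1), (12, 1), (16, 1)] 2) (.nog 8) (.pack [(0, 1), (2, 1), (3, 1), (5, 1), (6, 1), (7, 1), (8,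
  1), (9, 1), (12, 1), (16, 1)] 2)))) (.split [3, 12] (.pack [(0, 2), (1, 1), (2, 1), (3, 1),
  (4, 1), (5, 1), (6, 1), (7, 1), (12, 1)] 2) (.split [4, 12] (.pack [(0, 1), (1, 1), (4, 1),
  (6, 1), (12, 1)] 1) (.split [6, 17] (.hex 3 7 4 17 12 16 (.nog 3) (.walk 0) (.hex 2 6 3 16 12
  15 (.walk 1) (.nog 12) (.hex 7 3 15 12 17 4 (.walk 0) (.nog 3) (.walk 1)))) (.hex 2 15 12 17
  18 6 (.walk 1) (.hex 1 5 2 10 8 9 (.hex 0 8 10 2 15 12 (.nog 2) (.hex 3 7 4 17 18 6 (.hex 2 6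
  3 17 12 15 (.walk 1) (.nog 12) (.walk 3)) (.walk 7) (.walk 1)) (.walk 1)) (.nog 8) (.hex 0 8 9
  2 15 12 (.nog 2) (.hex 3 7 4 17 18 6 (.hex 2 6 3 17 12 15 (.walk 1) (.nog 12) (.walk 3))
  (.walk 7) (.walk 1)) (.walk 1))) (.nog 12)))))

/-- A vertex close to `0` only, and a walk of length four to `3` whose first vertex is not close to
`6`. -/
def sideCert : Cert :=
  .split [2, 9] (.pack [(0, 1), (2, 1), (4, 1), (7, 1), (9, 1)] 1) (.split [3, 9] (.pack [(0,
  1), (3, 1), (5, 1), (7, 1), (9, 1)] 1) (.split [3, 8] (.split [6, 8] (.split [6, 10] (.pack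
  [(1, 1), (3, 1), (6, 1), (8, 1), (10, 1)] 1) (.pack [(0, 1), (3, 1), (6, 1), (8, 1), (11, 1)]
  1)) (.split [10, 14] (.split [5, 10] (.pack [(5, 1), (7, 1), (9, 1), (10, 1), (14, 1)] 1)
  (.hex 1 4 11 10 15 5 (.walk 0) (.pack [(0, 1), (3, 1), (4, 1), (6, 1), (7, 1), (8, 1), (9, 1),
  (10, 1), (14, 1), (15, 1)] 2) (.pack [(0, 1), (3, 1), (4, 1), (6, 1), (7, 1), (8, 1), (9, 1),
  (10, 1), (11, 1), (14, 1)] 2))) (.pack [(1, 1), (3, 1), (4, 1), (6, 1), (8, 1), (9, 1), (10,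
  1), (11, 1), (13, 1), (14, 1)] 2))) (.hex 1 4 7 3 14 8 (.walk 1) (.hex 2 6 3 13 9 12 (.hex 0 9
  13 3 14 8 (.nog 3) (.walk 4) (.walk 1)) (.nog 9) (.hex 0 9 12 3 14 8 (.nog 3) (.walk 4) (.walk
  1))) (.nog 8))))

/-- A vertex close to `0` only, with walks of length four to `3`, `4` whose first vertices are close
to `6`, `1`. -/
def bothSidesCert : Cert :=
  .split [2, 9] (.split [6, 9] (.pack [(0, 1), (2, 1), (4, 1), (6, 1), (9, 1)] 1) (.split [3,
  12] (.split [7, 12] (.pack [(0, 1), (3, 1), (5, 1), (7, 1), (12, 1)] 1) (.gap [7, 1, 2, 3, 4,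
  5, 6] 12 18 16 (.walk 0))) (.hex 2 6 3 18 12 16 (.hex 6 3 7 15 9 17 (.pack [(0, 1), (1, 1),
  (2, 1), (4, 1), (5, 1), (7, 1), (9, 1), (12, 1), (15, 1), (18, 1)] 2) (.walk 0) (.pack [(0,
  1), (1, 1), (2, 1), (4, 1), (5, 1), (7, 1), (9, 1), (12, 1), (17, 1), (18, 1)] 2)) (.walk 0)
  (.hex 6 3 7 15 9 17 (.pack [(0, 1), (1, 1), (2, 1), (4, 1), (5, 1), (7, 1), (9, 1), (12, 1),
  (15, 1), (16, 1)] 2) (.walk 0) (.pack [(0, 1), (1, 1), (2, 1), (4, 1), (5, 1), (7, 1), (9, 1),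
  (12, 1), (16, 1), (17, 1)] 2))))) (.gap [7, 1, 2, 3, 4, 5, 6] 9 15 17 (.walk 0))

/-- A vertex sharing one neighbour with the heptagon vertices `0`, `1` and one with `1`, `2`, and
with walks of length four to `4`, `5`. -/
def tripleCert : Cert :=
  .split [1, 14] (.split [5, 14] (.pack [(1, 1), (3, 1), (5, 1), (10, 1), (14, 1)] 1) (.split
  [4, 14] (.split [7, 13] (.hex 2 6 15 14 16 5 (.walk 0) (.pack [(0, 1), (1, 1), (3, 1), (4, 1),
  (5, 1), (7, 1), (9, 1), (13, 1), (14, 1), (16, 1)] 2) (.pack [(0, 1), (1, 1), (3, 1), (4, 1),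
  (5, 1), (7, 1), (9, 1), (13, 1), (14, 1), (15, 1)] 2)) (.hex 2 6 15 14 16 5 (.walk 0) (.pack
  [(0, 1), (1, 1), (3, 1), (4, 1), (6, 1), (7, 1), (8, 1), (13, 1), (14, 1), (16, 1)] 2) (.pack
  [(0, 1), (1, 1), (3, 1), (4, 1), (6, 1), (7, 1), (8, 1), (13, 1), (14, 1), (15, 1)] 2)))
  (.pack [(0, 1), (1, 1), (3, 1), (4, 1), (6, 1), (7, 1), (8, 1), (13, 1), (14, 1), (15, 1)]
  2))) (.hex 0 8 1 16 14 13 (.hex 5 2 9 0 16 1 (.walk 0) (.walk 2) (.walk 1)) (.walk 2) (.hex 5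
  2 9 0 13 1 (.walk 0) (.walk 2) (.walk 1)))


section

variable {V : Type*} [Fintype V] {G : SimpleGraph V}

/-- A checked certificate refutes a configuration given by the list `l` of its vertices. -/
theorem refute (h5 : NoClosedFiveWalk G) (hd : DenseFifth G) {hx gp : Bool}
    (hhex : hx = true → HexagonChord G) (hgap : gp = true → HeptagonConvex G) (t : Cert)
    (v₀ : V) (l : List V) (n : ℕ) (E : List (ℕ × ℕ)) (N : List (List ℕ))
    (hc : check hx gp t n E N = true)
    (hE : ∀ e ∈ E, G.Adj (l.getD e.1 v₀) (l.getD e.2 v₀))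
    (hN : ∀ p ∈ N, ∀ v, ¬ ∀ i ∈ p, G.Adj v (l.getD i v₀)) : False :=
  check_sound h5 hd hhex hgap t (ρ := fun i => l.getD i v₀) hc ⟨hE, hN⟩

theorem hexagonChord (h5 : NoClosedFiveWalk G) (hd : DenseFifth G) (hs : FourWalkSaturated G) :
    HexagonChord G := by
  intro a b c d e f hab hbc hcd hde hef hfa
  by_contra! h
  obtain ⟨p, q, r, h1, h2, h3, h4⟩ := hs _ _ h.1
  obtain ⟨p', q', r', h1', h2', h3', h4'⟩ := hs _ _ h.2.1
  obtain ⟨s, t, u, k1, k2, k3, k4⟩ := hs _ _ h.2.2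
  -- The edges are the hexagon on `0, …, 5` and a four-walk between each antipodal pair. Only the
  -- counting rules are available at this stage.
  refine refute h5 hd (hx := false) (gp := false) (by simp) (by simp) hexagonCert a
    [a, b, c, d, e, f, p, q, r, p', q', r', s, t, u] 15
    [(0, 1), (1, 2), (2, 3), (3, 4), (4, 5), (5, 0), (0, 6), (6, 7), (7, 8), (8, 3),
      (1, 9), (9, 10), (10, 11), (11, 4), (2, 12), (12, 13), (13, 14), (14, 5)] []
    (by decide +kernel) ?_ (by simp)
  simp [*]

/-- A configuration consisting of a vertex `k`, a heptagon and the vertices in the list `l`. -/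
theorem refute_heptagon (h5 : NoClosedFiveWalk G) (hd : DenseFifth G) {gp : Bool}
    (hhex : HexagonChord G) (hgap : gp = true → HeptagonConvex G) (t : Cert)
    (k : V) {y : ZMod 7 → V} (hy : IsHeptagon G y) (l : List V) (n : ℕ) (E : List (ℕ × ℕ))
    (N : List (ℕ × ℕ))
    (hc : check true gp t n (E ++ heptagonEdges) (N.map fun p => [p.1, p.2]) = true)
    (hE : ∀ e ∈ E, G.Adj ((k :: y 0 :: y 1 :: y 2 :: y 3 :: y 4 :: y 5 :: y 6 :: l).getD e.1 k)
      ((k :: y 0 :: y 1 :: y 2 :: y 3 :: y 4 :: y 5 :: y 6 :: l).getD e.2 k))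
    (hN : ∀ p ∈ N, ¬ Close G
      ((k :: y 0 :: y 1 :: y 2 :: y 3 :: y 4 :: y 5 :: y 6 :: l).getD p.1 k)
      ((k :: y 0 :: y 1 :: y 2 :: y 3 :: y 4 :: y 5 :: y 6 :: l).getD p.2 k)) : False := by
  refine refute h5 hd (fun _ => hhex) hgap t k
    (k :: y 0 :: y 1 :: y 2 :: y 3 :: y 4 :: y 5 :: y 6 :: l) n (E ++ heptagonEdges) _ hc
    (fun e he => ?_) fun p hp v hv => ?_
  rcases List.mem_append.1 he with he | he
  · exact hE e he
  · simp only [heptagonEdges, List.mem_cons, List.not_mem_nil, or_false] at he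
    rcases he with rfl | rfl | rfl | rfl | rfl | rfl | rfl
    · exact hy 0
    · exact hy 1
    · exact hy 2
    · exact hy 3
    · exact hy 4
    · exact hy 5
    · exact hy 6
  · obtain ⟨q, hq, rfl⟩ := List.mem_map.1 hp
    exact hN q hq ⟨v, hv _ (by simp), hv _ (by simp)⟩

end

end Refutation

/-! ### Every vertex has a neighbour on every heptagon -/

theorem IsHeptagon.shift {V : Type*} {G : SimpleGraph V} {y : ZMod 7 → V} (hy : IsHeptagon G y)
    (t : ZMod 7) : IsHeptagon G fun j => y (j + t) := fun j => by
  have := hy (j + t)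
  rwa [add_right_comm] at this

theorem IsHeptagon.reflect {V : Type*} {G : SimpleGraph V} {y : ZMod 7 → V}
    (hy : IsHeptagon G y) : IsHeptagon G fun j => y (-j) := fun j => by
  have := (hy (-(j + 3))).symm
  rwa [show -(j + 3) + 3 = -j by ring] at this

theorem IsHeptagon.adj_four {V : Type*} {G : SimpleGraph V} {y : ZMod 7 → V}
    (hy : IsHeptagon G y) (j : ZMod 7) : G.Adj (y (j + 4)) (y j) := by
  have := hy (j + 4)
  rwa [add_assoc, show (4 + 3 : ZMod 7) = 0 by decide, add_zero] at this

/-- A vertex close to two adjacent points of a heptagon and to the vertex between them shares a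
neighbour with both of them. -/
theorem exists_common_adj {V : Type*} {G : SimpleGraph V} (hhex : HexagonChord G)
    {y : ZMod 7 → V} (hy : IsHeptagon G y) {k : V}
    (j : ZMod 7) (h0 : Close G k (y j)) (h1 : Close G k (y (j + 1))) :
    ∃ n, G.Adj k n ∧ G.Adj n (y j) ∧ G.Adj n (y (j + 1)) := by
  obtain ⟨p, hpk, hp⟩ := h0
  obtain ⟨q, hqk, hq⟩ := h1
  have h4 := hy.adj_four j
  have h4' : G.Adj (y (j + 1)) (y (j + 4)) := by
    have := hy (j + 1)
    rwa [add_assoc, show (1 + 3 : ZMod 7) = 4 by decide] at this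
  rcases hhex k p (y j) (y (j + 4)) (y (j + 1)) q hpk.symm hp h4.symm h4'.symm hq.symm hqk
    with h | h | h
  · exact ⟨_, h, h4, h4'.symm⟩
  · exact ⟨p, hpk.symm, hp, h⟩
  · exact ⟨q, hqk.symm, h.symm, hq⟩

theorem DenseFifth.exists_adj {V : Type*} [Fintype V] {G : SimpleGraph V} (hd : DenseFifth G)
    (v : V) : ∃ w, G.Adj v w := by
  classical
  by_contra! h
  have := hd v
  simp [h] at this

section

variable {V : Type*} [Fintype V] {G : SimpleGraph V}

open Refutation

theorem adj_of_close_triple (h5 : NoClosedFiveWalk G) (hd : DenseFifth G)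
    (hs : FourWalkSaturated G) {y : ZMod 7 → V} (hy : IsHeptagon G y) {k n m : V}
    (hk : G.Adj k n) (hn0 : G.Adj n (y 0)) (hn1 : G.Adj n (y 1)) (hkm : G.Adj k m)
    (hm1 : G.Adj m (y 1)) (hm2 : G.Adj m (y 2)) : G.Adj k (y 4) ∨ G.Adj k (y 5) := by
  by_contra! h
  obtain ⟨a, b, d, h1, h2, h3, h4⟩ := hs _ _ h.1
  obtain ⟨a', b', d', h1', h2', h3', h4'⟩ := hs _ _ h.2
  exact refute_heptagon h5 hd (gp := false) (hexagonChord h5 hd hs) (by simp) tripleCert k hy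
    [n, m, a, b, d, a', b', d'] 16
    [(0, 8), (8, 1), (8, 2), (0, 9), (9, 2), (9, 3), (0, 10), (10, 11), (11, 12), (12, 5), (0, 13),
      (13, 14), (14, 15), (15, 6)] [] (by decide +kernel) (by simp [*]) (by simp)

theorem heptagonConvex (h5 : NoClosedFiveWalk G) (hd : DenseFifth G)
    (hs : FourWalkSaturated G) : HeptagonConvex G := by
  intro y k hy h0 h2
  by_contra hk
  obtain ⟨n, hnk, hn⟩ := h0
  obtain ⟨m, hmk, hm⟩ := h2
  -- `y 4` and `y 5` are the heptagon neighbours of `y 1`; if `k` were adjacent to either, it would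
  -- be close to `y 1`.
  obtain ⟨a, b, d, h1, h2, h3, h4⟩ := hs k (y 4) fun h => hk ⟨_, h.symm, (hy 1).symm⟩
  obtain ⟨a', b', d', h1', h2', h3', h4'⟩ := hs k (y 5) fun h => hk ⟨_, h.symm, hy 5⟩
  refine refute_heptagon h5 hd (gp := false) (hexagonChord h5 hd hs) (by simp) convexCert k hy
    [n, m, a, b, d, a', b', d'] 16
    [(0, 8), (8, 1), (0, 9), (9, 3), (0, 10), (10, 11), (11, 12), (12, 5), (0, 13), (13, 14),
      (14, 15), (15, 6)] [(0, 2)] (by decide +kernel) (by simp [*, hnk.symm, hmk.symm]) ?_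
  simpa using hk

theorem adj_of_close_zero_two (h5 : NoClosedFiveWalk G) (hd : DenseFifth G)
    (hs : FourWalkSaturated G) {y : ZMod 7 → V} (hy : IsHeptagon G y) {k : V}
    (h0 : Close G k (y 0)) (h2 : Close G k (y 2)) : ∃ j, G.Adj k (y j) := by
  have h1 := heptagonConvex h5 hd hs y k hy h0 h2
  obtain ⟨n, hkn, hn0, hn1⟩ := exists_common_adj (hexagonChord h5 hd hs) hy 0 h0 h1
  obtain ⟨m, hkm, hm1, hm2⟩ := exists_common_adj (hexagonChord h5 hd hs) hy 1 h1 h2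
  rcases adj_of_close_triple h5 hd hs hy hkn hn0 hn1 hkm hm1 hm2 with h | h
  · exact ⟨_, h⟩
  · exact ⟨_, h⟩

theorem adj_of_close_zero_one (h5 : NoClosedFiveWalk G) (hd : DenseFifth G)
    (hs : FourWalkSaturated G) {y : ZMod 7 → V} (hy : IsHeptagon G y) {k : V}
    (h0 : Close G k (y 0)) (h1 : Close G k (y 1)) : ∃ j, G.Adj k (y j) := by
  by_cases h2 : Close G k (y 2)
  · exact adj_of_close_zero_two h5 hd hs hy h0 h2
  by_cases h6 : Close G k (y 6)
  · obtain ⟨j, hj⟩ := adj_of_close_zero_two h5 hd hs (hy.shift 6) (k := k) h6 h1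
    exact ⟨_, hj⟩
  obtain ⟨n, hkn, hn0, hn1⟩ := exists_common_adj (hexagonChord h5 hd hs) hy 0 h0 h1
  by_contra! h
  obtain ⟨a, b, d, ka, ab, bd, dy⟩ := hs _ _ (h 4)
  -- Since `n` is adjacent to `y 0` and `y 1`, it can replace `y 4`; the certificate applies
  -- convexity to this second heptagon.
  refine refute_heptagon h5 hd (gp := true) (hexagonChord h5 hd hs)
    (fun _ => heptagonConvex h5 hd hs) nextCert k hy [n, a, b, d] 12
    [(0, 8), (8, 1), (8, 2), (0, 9), (9, 10), (10, 11), (11, 5)] [(0, 3), (0, 7)]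
    (by decide +kernel) (by simpa using ⟨hkn, hn0, hn1, ka, ab, bd, dy⟩) ?_
  simpa using ⟨h2, h6⟩

/-- Controls the first vertex of a four-walk to `y 3` when `k` is close to `y 0` but to none of its
four nearest heptagon vertices. Its mirror image handles `y 4`, and the two together give a
contradiction in `adj_of_close_zero`. -/
theorem side_close (h5 : NoClosedFiveWalk G) (hd : DenseFifth G)
    (hs : FourWalkSaturated G) {y : ZMod 7 → V} (hy : IsHeptagon G y) {k a b d : V}
    (h0 : Close G k (y 0)) (h1 : ¬ Close G k (y 1)) (h2 : ¬ Close G k (y 2))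
    (h5' : ¬ Close G k (y 5)) (h6 : ¬ Close G k (y 6)) (ka : G.Adj k a) (ab : G.Adj a b)
    (bd : G.Adj b d) (hdy : G.Adj d (y 3)) : Close G a (y 6) := by
  by_contra ha
  obtain ⟨n, hnk, hn⟩ := h0
  refine refute_heptagon h5 hd (gp := true) (hexagonChord h5 hd hs)
    (fun _ => heptagonConvex h5 hd hs) sideCert k hy [n, a, b, d] 12
    [(0, 8), (8, 1), (0, 9), (9, 10), (10, 11), (11, 4)] [(0, 2), (0, 3), (0, 6), (0, 7), (9, 7)]
    (by decide +kernel) (by simpa using ⟨hnk.symm, hn, ka, ab, bd, hdy⟩) ?_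
  simpa using ⟨h1, h2, h5', h6, ha⟩

theorem adj_of_close_zero (h5 : NoClosedFiveWalk G) (hd : DenseFifth G)
    (hs : FourWalkSaturated G) {y : ZMod 7 → V} (hy : IsHeptagon G y) {k : V}
    (h0 : Close G k (y 0)) : ∃ j, G.Adj k (y j) := by
  by_cases h1 : Close G k (y 1)
  · exact adj_of_close_zero_one h5 hd hs hy h0 h1
  by_cases h6 : Close G k (y 6)
  · obtain ⟨j, hj⟩ := adj_of_close_zero_one h5 hd hs (hy.shift 6) (k := k) h6 h0
    exact ⟨_, hj⟩
  by_cases h2 : Close G k (y 2)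
  · exact adj_of_close_zero_two h5 hd hs hy h0 h2
  by_cases h5' : Close G k (y 5)
  · obtain ⟨j, hj⟩ := adj_of_close_zero_two h5 hd hs (hy.shift 5) (k := k) h5' h0
    exact ⟨_, hj⟩
  by_contra! h
  obtain ⟨a, b, d, ka, ab, bd, dy⟩ := hs _ _ (h 3)
  obtain ⟨a', b', d', ka', ab', bd', dy'⟩ := hs _ _ (h 4)
  obtain ⟨p, hpa, hp⟩ := side_close h5 hd hs hy h0 h1 h2 h5' h6 ka ab bd dy
  -- Reflection exchanges `3` with `4` and `6` with `1`, so `a'` is close to `y 1`.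
  obtain ⟨q, hqa, hq⟩ := side_close h5 hd hs hy.reflect (k := k) h0 h6 h5' h2 h1 ka' ab' bd' dy'
  obtain ⟨n, hnk, hn⟩ := h0
  refine refute_heptagon h5 hd (gp := true) (hexagonChord h5 hd hs)
    (fun _ => heptagonConvex h5 hd hs) bothSidesCert k hy [n, a, b, d, a', b', d', p, q] 17
    [(0, 8), (8, 1), (0, 9), (9, 10), (10, 11), (11, 4), (0, 12), (12, 13), (13, 14), (14, 5),
      (15, 9), (15, 7), (16, 12), (16, 2)] [(0, 2), (0, 3), (0, 6), (0, 7)]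
    (by decide +kernel)
    (by simpa using ⟨hnk.symm, hn, ka, ab, bd, dy, ka', ab', bd', dy', hpa, hp, hqa, hq⟩) ?_
  simpa using ⟨h1, h2, h5', h6⟩

/-- A neighbour of a vertex far from a heptagon is close to three consecutive vertices of it. -/
theorem exists_three_close (h5 : NoClosedFiveWalk G) (hd : DenseFifth G)
    (hs : FourWalkSaturated G) {y : ZMod 7 → V} (hy : IsHeptagon G y) {k n : V}
    (hk : ∀ j, ¬ Close G k (y j)) (hkn : G.Adj k n) :
    ∃ j, Close G n (y j) ∧ Close G n (y (j + 1)) ∧ Close G n (y (j + 6)) := by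
  have pair : ∀ {y : ZMod 7 → V}, IsHeptagon G y → (∀ j, ¬ Close G k (y j)) → Close G n (y 0) →
      Close G n (y 1) → Close G n (y 2) ∨ Close G n (y 6) := by
    intro y hy hk h0 h1
    by_contra! h
    obtain ⟨p, hpn, hp⟩ := h0
    obtain ⟨q, hqn, hq⟩ := h1
    refine refute_heptagon h5 hd (gp := false) (hexagonChord h5 hd hs) (by simp) isolatedPairCert
      k hy [n, p, q] 11 [(8, 0), (8, 9), (9, 1), (8, 10), (10, 2)]
      [(0, 1), (0, 2), (0, 3), (0, 4), (0, 5), (0, 6), (0, 7), (8, 3), (8, 7)]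
      (by decide +kernel) (by simpa using ⟨hkn.symm, hpn.symm, hp, hqn.symm, hq⟩) ?_
    simpa using ⟨(hk 0), hk 1, hk 2, hk 3, hk 4, hk 5, hk 6, h.1, h.2⟩
  have start : ∀ {y : ZMod 7 → V}, IsHeptagon G y → (∀ j, ¬ Close G k (y j)) → Close G n (y 0) →
      ∃ j, Close G n (y j) ∧ Close G n (y (j + 1)) ∧ Close G n (y (j + 6)) := by
    intro y hy hk h0
    by_cases h1 : Close G n (y 1)
    · rcases pair hy hk h0 h1 with h | h
      · exact ⟨1, h1, h, h0⟩
      · exact ⟨0, h0, h1, h⟩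
    by_cases h6 : Close G n (y 6)
    · rcases pair (hy.shift 6) (fun j => hk _) h6 h0 with h | h
      · exact absurd h h1
      · exact ⟨6, h6, h0, h⟩
    exfalso
    obtain ⟨p, hpn, hp⟩ := h0
    refine refute_heptagon h5 hd (gp := false) (hexagonChord h5 hd hs) (by simp) isolatedCert
      k hy [n, p] 10 [(8, 0), (8, 9), (9, 1)]
      [(0, 1), (0, 2), (0, 3), (0, 4), (0, 5), (0, 6), (0, 7), (8, 2), (8, 7)]
      (by decide +kernel) (by simpa using ⟨hkn.symm, hpn.symm, hp⟩) ?_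
    simpa using ⟨(hk 0), hk 1, hk 2, hk 3, hk 4, hk 5, hk 6, h1, h6⟩
  by_cases h0 : Close G n (y 0)
  · exact start hy hk h0
  by_cases h2 : Close G n (y 2)
  · obtain ⟨j, ha, hb, hc⟩ := start (hy.shift 2) (fun j => hk _) h2
    exact ⟨j + 2, ha, by rwa [add_right_comm], by rwa [add_right_comm]⟩
  by_cases h4 : Close G n (y 4)
  · obtain ⟨j, ha, hb, hc⟩ := start (hy.shift 4) (fun j => hk _) h4
    exact ⟨j + 4, ha, by rwa [add_right_comm], by rwa [add_right_comm]⟩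
  exfalso
  -- No two of the five points `k`, `n`, `y 0`, `y 2`, `y 4` have a common neighbour.
  refine refute_heptagon h5 hd (gp := false) (hexagonChord h5 hd hs) (by simp)
    (.pack [(0, 1), (1, 1), (3, 1), (5, 1), (8, 1)] 1) k hy [n] 9 [(8, 0)]
    [(0, 1), (0, 3), (0, 5), (8, 1), (8, 3), (8, 5)]
    (by decide +kernel) (by simpa using hkn.symm) ?_
  simpa using ⟨(hk 0), hk 2, hk 4, h0, h2, h4⟩

/-- Every vertex has a neighbour on every heptagon. -/
theorem exists_adj_heptagon (h5 : NoClosedFiveWalk G) (hd : DenseFifth G)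
    (hs : FourWalkSaturated G) {y : ZMod 7 → V} (hy : IsHeptagon G y) (k : V) :
    ∃ j, G.Adj k (y j) := by
  by_cases hk : ∃ j, Close G k (y j)
  · obtain ⟨j, hj⟩ := hk
    obtain ⟨i, hi⟩ := adj_of_close_zero h5 hd hs (hy.shift j) (k := k) (by simpa using hj)
    exact ⟨_, hi⟩
  by_contra! h
  rw [not_exists] at hk
  obtain ⟨n, hkn⟩ := hd.exists_adj k
  obtain ⟨j, hj0, hj1, hj6⟩ := exists_three_close h5 hd hs hy hk hkn
  obtain ⟨a, b, d, ka, ab, bd, dy⟩ := hs _ _ (h j)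
  obtain ⟨p, hpn, hp⟩ := hj0
  obtain ⟨q, hqn, hq⟩ := hj1
  obtain ⟨r, hrn, hr⟩ := hj6
  refine refute_heptagon h5 hd (gp := false) (hexagonChord h5 hd hs) (by simp) farCert
    k (hy.shift j) [n, p, q, r, a, b, d] 15
    [(8, 0), (8, 9), (9, 1), (8, 10), (10, 2), (8, 11), (11, 7), (0, 12), (12, 13), (13, 14),
      (14, 1)]
    [(0, 1), (0, 2), (0, 3), (0, 4), (0, 5), (0, 6), (0, 7)]
    (by decide +kernel) ?_ ?_
  · rw [add_comm j 1] at hq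
    rw [add_comm j 6] at hr
    simpa using ⟨hkn.symm, hpn.symm, hp, hqn.symm, hq, hrn.symm, hr, ka, ab, bd, dy⟩
  · have hk' := fun i => hk (i + j)
    simpa using ⟨hk j, hk' 1, hk' 2, hk' 3, hk' 4, hk' 5, hk' 6⟩

end

/-! ### Walks with length and total weight -/

/-- `WeightedWalk G m ℓ M u v`: there is a walk from `u` to `v` of length `ℓ` along which the
values of `m` add up to `M`. -/
inductive WeightedWalk {V : Type*} (G : SimpleGraph V) (m : V → V → ℤ) : ℕ → ℤ → V → V → Prop
  | nil (u : V) : WeightedWalk G m 0 0 u u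
  | snoc {ℓ : ℕ} {M : ℤ} {u v w : V} (h : WeightedWalk G m ℓ M u v) (hvw : G.Adj v w) :
      WeightedWalk G m (ℓ + 1) (M + m v w) u w

namespace WeightedWalk

variable {V : Type*} {G : SimpleGraph V} {m : V → V → ℤ} {ℓ ℓ' : ℕ} {M M' : ℤ} {u v w : V}

theorem trans (h : WeightedWalk G m ℓ M u v) (h' : WeightedWalk G m ℓ' M' v w) :
    WeightedWalk G m (ℓ + ℓ') (M + M') u w := by
  induction h' with
  | nil => simpa using h
  | snoc _ hvw ih => simpa only [add_assoc] using (ih h).snoc hvw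

theorem single (h : G.Adj u v) : WeightedWalk G m 1 (m u v) u v := by
  simpa using (nil u).snoc (m := m) h

theorem reverse (hanti : ∀ u v, G.Adj u v → m v u = -m u v) (h : WeightedWalk G m ℓ M u v) :
    WeightedWalk G m ℓ (-M) v u := by
  induction h with
  | nil => simpa using nil (m := m) _
  | @snoc ℓ M u v w _ hvw ih =>
    have := (single hvw.symm).trans ih
    rwa [hanti v w hvw, add_comm 1, ← neg_add, add_comm (m v w)] at this

theorem odd_iff (hodd : ∀ u v, G.Adj u v → Odd (m u v)) (h : WeightedWalk G m ℓ M u v) :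
    (M - ℓ) % 2 = 0 := by
  induction h with
  | nil => simp
  | snoc _ hvw ih =>
    obtain ⟨a, ha⟩ := hodd _ _ hvw
    push_cast
    omega

theorem exists_seq (h : WeightedWalk G m ℓ M u v) :
    ∃ c : ℕ → V, c 0 = u ∧ c ℓ = v ∧ (∀ i < ℓ, G.Adj (c i) (c (i + 1))) ∧
      ∑ i ∈ Finset.range ℓ, m (c i) (c (i + 1)) = M := by
  induction h with
  | nil u => exact ⟨fun _ => u, rfl, rfl, by simp, by simp⟩
  | @snoc ℓ M u v w _ hvw ih =>
    obtain ⟨c, h0, hℓ, hadj, hsum⟩ := ih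
    refine ⟨fun i => if i ≤ ℓ then c i else w, by simpa using h0, by simp, fun i hi => ?_, ?_⟩
    · rcases Nat.lt_succ_iff_lt_or_eq.1 hi with h | rfl
      · simpa [h.le, Nat.succ_le_of_lt h] using hadj i h
      · simpa [hℓ] using hvw
    · rw [Finset.sum_range_succ, ← hsum]
      congr 1
      · refine Finset.sum_congr rfl fun i hi => ?_
        have h := Finset.mem_range.1 hi
        simp [h.le, Nat.succ_le_of_lt h]
      · simp [hℓ]

theorem segment {c : ℕ → V} {i j : ℕ} (hij : i ≤ j)
    (hadj : ∀ t, i ≤ t → t < j → G.Adj (c t) (c (t + 1))) :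
    WeightedWalk G m (j - i) (∑ t ∈ Finset.range j, m (c t) (c (t + 1)) -
      ∑ t ∈ Finset.range i, m (c t) (c (t + 1))) (c i) (c j) := by
  induction j, hij using Nat.le_induction with
  | base => simpa using nil (m := m) _
  | succ j hij ih =>
    have h := (ih fun t h1 h2 => hadj t h1 (h2.trans j.lt_succ_self)).snoc
      (hadj j hij j.lt_succ_self)
    rwa [← Nat.succ_sub_one (j - i), ← Nat.succ_sub_one (j - i), Nat.succ_sub_one,
      Nat.succ_sub_one, ← Nat.sub_add_comm hij, sub_add_eq_add_sub, ← Finset.sum_range_succ] at h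

/-- A closed walk as a periodic sequence. -/
theorem exists_periodic (hℓ : 0 < ℓ) (h : WeightedWalk G m ℓ M u u) :
    ∃ c : ℕ → V, (∀ i, c (i + ℓ) = c i) ∧ (∀ i, G.Adj (c i) (c (i + 1))) ∧
      ∑ i ∈ Finset.range ℓ, m (c i) (c (i + 1)) = M := by
  obtain ⟨c, h0, hc, hadj, hsum⟩ := h.exists_seq
  have hmod : ∀ i, c ((i + 1) % ℓ) = c (i % ℓ + 1) := by
    intro i
    have hlt := Nat.mod_lt i hℓ
    rcases Nat.lt_or_ge (i % ℓ + 1) ℓ with h | h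
    · rw [Nat.add_mod, Nat.mod_eq_of_lt (a := 1) (by omega), Nat.mod_eq_of_lt h]
    · have he : i % ℓ + 1 = ℓ := by omega
      rw [he, hc, ← h0]
      congr 1
      have : (i + 1) % ℓ = (i % ℓ + 1) % ℓ := by simp
      rw [this, he, Nat.mod_self]
  refine ⟨fun i => c (i % ℓ), fun i => by simp, fun i => ?_, ?_⟩
  · simp only [hmod]
    exact hadj _ (Nat.mod_lt i hℓ)
  · rw [← hsum]
    refine Finset.sum_congr rfl fun i hi => ?_
    simp only [hmod, Nat.mod_eq_of_lt (Finset.mem_range.1 hi)]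

end WeightedWalk

/-! ### The winding inequality -/

section winding

variable {V : Type*} [Fintype V] {G : SimpleGraph V} {m : V → V → ℤ}

open WeightedWalk

/-- In a dense graph some vertex is adjacent to more than a fifth of the positions of a closed
sequence. -/
theorem exists_many_hits (hd : DenseFifth G) {ℓ : ℕ} (hℓ : 0 < ℓ) (c : ℕ → V) :
    ∃ v, ∃ H : Finset ℕ, (∀ i, i ∈ H ↔ i < ℓ ∧ G.Adj v (c i)) ∧ ℓ < 5 * H.card := by
  classical
  by_contra! h
  have h' : ∀ v, 5 * ((Finset.range ℓ).filter fun i => G.Adj v (c i)).card ≤ ℓ := fun v =>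
    h v _ (by simp)
  have hsum : ∑ v, ((Finset.range ℓ).filter fun i => G.Adj v (c i)).card =
      ∑ i ∈ Finset.range ℓ, (Finset.univ.filter (G.Adj (c i))).card := by
    simp only [Finset.card_filter]
    rw [Finset.sum_comm]
    simp only [G.adj_comm]
  have h1 : 5 * ∑ v, ((Finset.range ℓ).filter fun i => G.Adj v (c i)).card ≤
      Fintype.card V * ℓ := by
    rw [Finset.mul_sum]
    simpa using Finset.sum_le_card_nsmul Finset.univ _ ℓ fun v _ => h' v
  have h2 : ℓ * (Fintype.card V + 1) ≤
      5 * ∑ i ∈ Finset.range ℓ, (Finset.univ.filter (G.Adj (c i))).card := by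
    rw [Finset.mul_sum]
    simpa using Finset.card_nsmul_le_sum (Finset.range ℓ)
      (fun i => 5 * (Finset.univ.filter (G.Adj (c i))).card) (Fintype.card V + 1)
      fun i _ => hd (c i)
  rw [hsum] at h1
  nlinarith

/-- If short closed walks have winding less than a fifth of their length, then so do all. -/
theorem winding_lt (hd : DenseFifth G) (h3 : ∀ a b c, G.Adj a b → G.Adj b c → ¬ G.Adj c a)
    (hodd : ∀ u v, G.Adj u v → Odd (m u v)) (hanti : ∀ u v, G.Adj u v → m v u = -m u v)
    (hsmall : ∀ ℓ M u, 0 < ℓ → ℓ < 10 → WeightedWalk G m ℓ M u u → 5 * M < ℓ) :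
    ∀ (ℓ : ℕ) (M : ℤ) (u : V), 0 < ℓ → WeightedWalk G m ℓ M u u → 5 * M < ℓ := by
  intro ℓ
  induction ℓ using Nat.strong_induction_on with
  | _ ℓ ih =>
  intro M u hℓ hw
  by_cases h10 : ℓ < 10
  · exact hsmall ℓ M u hℓ h10 hw
  by_contra! hM
  obtain ⟨c, hper, hadj, hsum⟩ := hw.exists_periodic hℓ
  obtain ⟨v, H, hH, hcard⟩ := exists_many_hits hd hℓ c
  set S : ℕ → ℤ := fun i => ∑ t ∈ Finset.range i, m (c t) (c (t + 1)) with hS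
  have hSper : ∀ i, S (i + ℓ) = S i + M := by
    intro i
    simp only [hS]
    rw [add_comm i, Finset.sum_range_add, hsum, add_comm]
    congr 1
    refine Finset.sum_congr rfl fun t _ => ?_
    rw [add_comm ℓ t, hper, add_right_comm, hper]
  -- `φ` compares winding with length after a detour to `v`. It does not increase from hit to hit by
  -- induction, yet does not decrease over a full period, so it is constant on the hits.
  set φ : ℕ → ℤ := fun i => 5 * (S i + m (c i) v) - i with hφ
  have hφper : ∀ i, φ i ≤ φ (i + ℓ) := by
    intro i
    simp only [hφ, hSper, hper]
    push_cast
    linarith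
  -- consecutive hits are not adjacent positions
  have hgap : ∀ i j, i < j → G.Adj v (c i) → G.Adj v (c j) → i + 2 ≤ j := by
    intro i j hij hi hj
    by_contra hlt
    obtain rfl : j = i + 1 := by omega
    exact h3 _ _ _ hi (hadj i) hj.symm
  have hmono : ∀ i j, i < j → j + 2 < i + ℓ → G.Adj v (c i) → G.Adj v (c j) → φ j ≤ φ i := by
    intro i j hij hjl hi hj
    have hseg := segment (m := m) hij.le fun t _ _ => hadj t
    have hclosed := ((single (m := m) hi).trans hseg).snoc hj.symm
    -- The shorter closed walk through `v` has length `j - i + 2`. Its weight has the same parity,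
    -- so the strict bound improves by two and absorbs the detour.
    have h1 := ih _ (by omega) _ v (by omega) hclosed
    have h2 := hclosed.odd_iff hodd
    have h4 := hanti v (c i) hi
    simp only [hφ, hS]
    push_cast [Nat.cast_sub hij.le] at h1 h2
    omega
  have hq : 2 < H.card := by omega
  have hne : H.Nonempty := Finset.card_pos.1 (by omega)
  set a := H.min' hne with ha
  obtain ⟨haℓ, hav⟩ := (hH a).1 (H.min'_mem hne)
  have hav' : G.Adj v (c (a + ℓ)) := by rwa [hper]
  -- When `j` is cyclically two from `a`, the walk through `v` the long way round has length `ℓ`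
  -- again; a third hit splits it into shorter ones.
  have hthird : ∀ j, ∃ k ∈ H, k ≠ a ∧ k ≠ j := by
    intro j
    obtain ⟨k, hk, hkj⟩ : ∃ k ∈ H, k ∉ ({a, j} : Finset ℕ) :=
      Finset.exists_mem_notMem_of_card_lt_card (lt_of_le_of_lt Finset.card_le_two hq)
    exact ⟨k, hk, by simpa using hkj⟩
  have hle : ∀ j ∈ H, j ≠ a → φ j ≤ φ a ∧ φ (a + ℓ) ≤ φ j := by
    intro j hj hja
    obtain ⟨hjℓ, hjv⟩ := (hH j).1 hj
    have haj : a < j := lt_of_le_of_ne (H.min'_le j hj) hja.symm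
    have g1 := hgap a j haj hav hjv
    have g2 := hgap j (a + ℓ) (by omega) hjv hav'
    obtain ⟨k, hk, hka, hkj⟩ := hthird j
    obtain ⟨hkℓ, hkv⟩ := (hH k).1 hk
    have hak : a < k := lt_of_le_of_ne (H.min'_le k hk) hka.symm
    have g3 := hgap a k hak hav hkv
    have g4 := hgap k (a + ℓ) (by omega) hkv hav'
    constructor
    · by_cases hlt : j + 2 < a + ℓ
      · exact hmono a j haj hlt hav hjv
      · have hkj' : k < j := by
          by_contra hh
          have := hgap j k (by omega) hjv hkv
          omega
        exact (hmono k j hkj' (by omega) hkv hjv).trans (hmono a k hak (by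
          have := hgap k j hkj' hkv hjv
          omega) hav hkv)
    · by_cases hlt : a + ℓ + 2 < j + ℓ
      · exact hmono j (a + ℓ) (by omega) hlt hjv hav'
      · have hjk : j < k := by
          by_contra hh
          have := hgap k j (by omega) hkv hjv
          omega
        exact (hmono k (a + ℓ) (by omega) (by
          have := hgap j k hjk hjv hkv
          omega) hkv hav').trans (hmono j k hjk (by omega) hjv hkv)
  have hφa := hφper a
  -- Constancy of `φ` puts all hits in one class modulo 5 and makes `ℓ` a multiple of 5, leaving at
  -- most `ℓ / 5` hits.
  have hmod : ∀ j ∈ H, j % 5 = a % 5 := by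
    intro j hj
    by_cases hja : j = a
    · rw [hja]
    · obtain ⟨h1, h2⟩ := hle j hj hja
      have h3 : φ j = φ a := by omega
      simp only [hφ] at h3
      omega
  have hdvd : ℓ % 5 = 0 := by
    obtain ⟨k, hk, hka, -⟩ := hthird a
    obtain ⟨h1, h2⟩ := hle k hk hka
    have h3 : φ (a + ℓ) = φ a := by omega
    simp only [hφ, hSper, hper] at h3
    push_cast at h3
    omega
  have hcard' : H.card ≤ (Finset.range (ℓ / 5)).card := by
    refine Finset.card_le_card_of_injOn (fun j => j / 5) (fun j hj => ?_) fun i hi j hj hij => ?_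
    · have := ((hH j).1 hj).1
      simp only [Finset.coe_range, Set.mem_Iio]
      omega
    · have h1 := hmod i hi
      have h2 := hmod j hj
      simp only at hij
      omega
  rw [Finset.card_range] at hcard'
  omega

end winding

/-! ### From winding to a homomorphism -/

section potential

variable {V : Type*} [Fintype V] {G : SimpleGraph V} {m : V → V → ℤ}

open WeightedWalk

/-- Closed walks have nonnegative cost. -/
theorem cost_nonneg (hodd : ∀ u v, G.Adj u v → Odd (m u v))
    (hanti : ∀ u v, G.Adj u v → m v u = -m u v)
    (hwind : ∀ (ℓ : ℕ) (M : ℤ) (u : V), 0 < ℓ → WeightedWalk G m ℓ M u u → 5 * M < ℓ) :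
    ∀ (ℓ : ℕ) (M : ℤ) (u : V), WeightedWalk G m ℓ M u u →
      0 ≤ (5 * (Fintype.card V : ℤ) + 2) * M + ℓ * Fintype.card V := by
  intro ℓ
  induction ℓ using Nat.strong_induction_on with
  | _ ℓ ih =>
  intro M u hw
  obtain ⟨c, h0, hℓ, hadj, hsum⟩ := hw.exists_seq
  rcases Nat.eq_zero_or_pos ℓ with rfl | hpos
  · simp only [Finset.range_zero, Finset.sum_empty] at hsum
    simp [← hsum]
  by_cases hn : ℓ ≤ Fintype.card V
  · have h1 := hwind ℓ _ u hpos (hw.reverse hanti)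
    have h2 := hw.odd_iff hodd
    -- Parity gains two here; for `ℓ ≤ n` this pays for the extra 2 in `5n + 2`. Longer closed walks
    -- repeat a vertex and are split there.
    have h3 : 5 * (-M) + 2 ≤ ℓ := by omega
    have h4 : (ℓ : ℤ) ≤ Fintype.card V := by exact_mod_cast hn
    rcases le_or_gt 0 M with hM | hM
    · positivity
    · nlinarith
  · obtain ⟨i, j, hij, hc⟩ : ∃ i j : Fin ℓ, i < j ∧ c i = c j := by
      obtain ⟨i, j, hne, hc⟩ := Fintype.exists_ne_map_eq_of_card_lt (fun i : Fin ℓ => c i)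
        (by simpa using hn)
      rcases lt_or_gt_of_ne hne with h | h
      · exact ⟨i, j, h, hc⟩
      · exact ⟨j, i, h, hc.symm⟩
    have hij' : (i : ℕ) < j := hij
    have hj := j.2
    have s1 := segment (m := m) (Nat.zero_le (i : ℕ)) fun t _ ht => hadj t (by omega)
    have s2 := segment (m := m) hij'.le fun t _ ht => hadj t (by omega)
    have s3 := segment (m := m) hj.le fun t _ ht => hadj t (by omega)
    rw [h0, hc] at s1
    rw [hc] at s2
    rw [hℓ] at s3
    have e1 := ih _ (by omega) _ _ s2
    have e2 := ih _ (by omega) _ _ (s1.trans s3)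
    push_cast [Nat.cast_sub hij'.le, Nat.cast_sub hj.le] at e1 e2
    rw [hsum] at e2
    simp only [Finset.range_zero, Finset.sum_empty, Nat.sub_zero] at e2
    linarith

/-- A vertex potential whose increments along edges lie in the middle part of a period. -/
theorem exists_potential (hodd : ∀ u v, G.Adj u v → Odd (m u v))
    (hanti : ∀ u v, G.Adj u v → m v u = -m u v)
    (hwind : ∀ (ℓ : ℕ) (M : ℤ) (u : V), 0 < ℓ → WeightedWalk G m ℓ M u u → 5 * M < ℓ) :
    ∃ x : V → ℤ, ∀ v w, G.Adj v w → ∃ t : ℤ,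
      2 * (Fintype.card V : ℤ) + 1 ≤ x w - x v - t * (5 * Fintype.card V + 2) ∧
      x w - x v - t * (5 * Fintype.card V + 2) ≤ 3 * Fintype.card V + 1 := by
  have hcost := cost_nonneg hodd hanti hwind
  set n : ℤ := (Fintype.card V : ℤ) with hn
  -- The potential is the least cost of a walk ending at `v`. It exists because closing any walk by
  -- the reverse of a fixed one gives nonnegative cost.
  have hmin : ∀ v, ∃ X : ℤ, (∃ ℓ M u, WeightedWalk G m ℓ M u v ∧ X = (5 * n + 2) * M + ℓ * n) ∧
      ∀ ℓ M u, WeightedWalk G m ℓ M u v → X ≤ (5 * n + 2) * M + ℓ * n := by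
    intro v
    have hb : ∀ u, ∃ b : ℤ, ∀ ℓ M, WeightedWalk G m ℓ M u v → b ≤ (5 * n + 2) * M + ℓ * n := by
      intro u
      by_cases h : ∃ ℓ M, WeightedWalk G m ℓ M u v
      · obtain ⟨ℓ, M, h⟩ := h
        refine ⟨(5 * n + 2) * M - ℓ * n, fun ℓ' M' h' => ?_⟩
        have := hcost _ _ _ (h'.trans (h.reverse hanti))
        push_cast at this
        linarith
      · exact ⟨0, fun ℓ M h' => (h ⟨ℓ, M, h'⟩).elim⟩
    choose b hb using hb
    obtain ⟨B, hB⟩ := (Set.finite_range b).bddBelow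
    obtain ⟨X, ⟨ℓ, M, u, h, hX⟩, hleast⟩ := Int.exists_least_of_bdd
      (P := fun X => ∃ ℓ M u, WeightedWalk G m ℓ M u v ∧ X = (5 * n + 2) * M + ℓ * n)
      ⟨B, fun X ⟨ℓ, M, u, h, hX⟩ => hX ▸ (hB ⟨u, rfl⟩).trans (hb u ℓ M h)⟩
      ⟨_, 0, 0, v, WeightedWalk.nil v, rfl⟩
    exact ⟨X, ⟨ℓ, M, u, h, hX⟩, fun ℓ M u h => hleast _ ⟨ℓ, M, u, h, rfl⟩⟩
  choose X hX hleast using hmin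
  have heven : ∀ v, X v % 2 = 0 := by
    intro v
    obtain ⟨ℓ, M, u, h, hX⟩ := hX v
    have h2 : (2 : ℤ) ∣ M - ℓ := Int.dvd_of_emod_eq_zero (h.odd_iff hodd)
    obtain ⟨t, ht⟩ := h2
    obtain rfl : M = ℓ + 2 * t := by linarith
    apply Int.emod_eq_zero_of_dvd
    exact ⟨(3 * n + 1) * ℓ + (5 * n + 2) * t, by rw [hX]; ring⟩
  have hstep : ∀ v w, G.Adj v w → X w ≤ X v + (5 * n + 2) * m v w + n := by
    intro v w hvw
    obtain ⟨ℓ, M, u, h, hX⟩ := hX v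
    have := hleast w _ _ _ (h.snoc hvw)
    push_cast at this
    linarith
  -- Along an edge `X` changes by `(5n + 2) * m v w` up to `n`, with `m v w = 2t + 1`; halving gives
  -- the stated window.
  refine ⟨fun v => X v / 2, fun v w hvw => ?_⟩
  obtain ⟨t, ht⟩ := hodd v w hvw
  have h1 := hstep v w hvw
  have h2 := hstep w v hvw.symm
  rw [hanti v w hvw] at h2
  have h3 := heven v
  have h4 := heven w
  rw [ht] at h1 h2
  have e1 : (5 * n + 2) * (2 * t + 1) = 2 * (t * (5 * n + 2)) + 5 * n + 2 := by ring
  have e2 : (5 * n + 2) * -(2 * t + 1) = -(2 * (t * (5 * n + 2)) + 5 * n + 2) := by ring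
  rw [e1] at h1
  rw [e2] at h2
  refine ⟨t, ?_, ?_⟩ <;> dsimp only <;> omega

/-- Odd antisymmetric edge weights of small winding define a homomorphism to a generalised
Andrásfai graph. -/
theorem nonempty_hom_of_winding (hodd : ∀ u v, G.Adj u v → Odd (m u v))
    (hanti : ∀ u v, G.Adj u v → m v u = -m u v)
    (hwind : ∀ (ℓ : ℕ) (M : ℤ) (u : V), 0 < ℓ → WeightedWalk G m ℓ M u u → 5 * M < ℓ) :
    Nonempty (G →g andrasfaiF (Fintype.card V + 1)) := by
  obtain ⟨x, hx⟩ := exists_potential hodd hanti hwind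
  have hN : (0 : ℤ) < 5 * (Fintype.card V : ℤ) + 2 := by positivity
  have hnn := fun v => Int.emod_nonneg (5 * x v) hN.ne'
  have hlt := fun v => Int.emod_lt_of_pos (5 * x v) hN
  -- With `N = 5n + 2` one has `5 * (2n + 1) = 2N + 1`, so multiplication by five sends the window
  -- `2n + 1, …, 3n + 1` to `1, 6, …, 5n + 1` modulo `N`. This set is symmetric and defines
  -- `F_{n+1}`.
  refine ⟨⟨fun v => ⟨(5 * x v % (5 * (Fintype.card V : ℤ) + 2)).toNat, ?_⟩, ?_⟩⟩
  · have := hnn v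
    have := hlt v
    omega
  · intro v w hvw
    obtain ⟨t, h1, h2⟩ := hx v w hvw
    have a1 := hnn v
    have a2 := hnn w
    have b1 := hlt v
    have b2 := hlt w
    have c1 := Int.emod_add_mul_ediv (5 * x v) (5 * (Fintype.card V : ℤ) + 2)
    have c2 := Int.emod_add_mul_ediv (5 * x w) (5 * (Fintype.card V : ℤ) + 2)
    set p := 5 * x v % (5 * (Fintype.card V : ℤ) + 2)
    set q := 5 * x w % (5 * (Fintype.card V : ℤ) + 2)
    set N := 5 * (Fintype.card V : ℤ) + 2 with hNdef
    set d := x w - x v - t * N with hd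
    have key : q - p = (5 * d - 2 * N) + N * (5 * t + 2 + 5 * x v / N - 5 * x w / N) := by
      rw [hd]
      linarith
    set z := 5 * t + 2 + 5 * x v / N - 5 * x w / N
    have hz : z = 0 ∨ z = -1 := by
      have z1 : z < 1 := by
        by_contra! hh
        nlinarith
      have z2 : -2 < z := by
        by_contra! hh
        nlinarith
      omega
    have hmod : ((q - p) % 5 = 1 ∧ p < q) ∨ ((p - q) % 5 = 1 ∧ q < p) := by
      rcases hz with hz | hz <;> rw [hz] at key <;> omega
    simp only [andrasfaiF, cyclicDist, Nat.ModEq, Nat.dist]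
    omega

end potential

/-! ### Placing the vertices on a circle of fourteen points -/

section types

variable {V : Type*} {G : SimpleGraph V} {y : ZMod 7 → V}

theorem NoClosedFiveWalk.triangle (h5 : NoClosedFiveWalk G) (a b c : V) (hab : G.Adj a b)
    (hbc : G.Adj b c) : ¬ G.Adj c a := fun hca =>
  h5 a b c a b hab hbc hca hab hab.symm

/-- A position `s` on a circle with fourteen points is near the `i`-th even point if their
distance is at most one. -/
def Near (s : Fin 14) (i : Fin 7) : Prop :=
  (i : ℕ) = (s : ℕ) / 2 ∨ (i : ℕ) = ((s : ℕ) + 1) / 2 % 7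

instance (s : Fin 14) (i : Fin 7) : Decidable (Near s i) :=
  inferInstanceAs (Decidable (_ ∨ _))

/-- A single neighbour `i` gives the even point `2i`; consecutive neighbours give the odd point
between them. -/
theorem exists_near : ∀ p : Fin 7 → Bool, (∃ j, p j = true) →
    (∀ i j : Fin 7, p i = true → p j = true → j - i = 0 ∨ j - i = 1 ∨ j - i = 6) →
    ∃ s : Fin 14, ∀ i : Fin 7, p i = true ↔ Near s i := by
  decide +kernel

/-- The first condition leaves differences `4, …, 10`. The extremes occur only for two even points,
where neither vertex has the second neighbour demanded by the other conditions. -/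
theorem near_edge : ∀ s t : Fin 14,
    (∀ i j : Fin 7, Near s i → Near t j → j - i ≠ 0 ∧ j - i ≠ 1 ∧ j - i ≠ 6) →
    (∀ i : Fin 7, Near s i → Near t (i + 2) → Near s (i - 1) ∨ Near t (i + 3)) →
    (∀ i : Fin 7, Near t i → Near s (i + 2) → Near t (i - 1) ∨ Near s (i + 3)) →
    5 ≤ ((t : ℕ) + 14 - s) % 14 ∧ ((t : ℕ) + 14 - s) % 14 ≤ 9 := by
  decide +kernel

theorem near_succ : ∀ s t : Fin 14, ((t : ℕ) + 1) % 14 = s → ∃ i, Near s i ∧ Near t i := by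
  decide +kernel

theorem IsHeptagon.not_adj_two (h5 : NoClosedFiveWalk G) (hy : IsHeptagon G y) (j : ZMod 7) :
    ¬ G.Adj (y j) (y (j + 2)) := by
  intro h
  have h1 := hy (j + 2)
  have h2 := hy (j + 5)
  have h3 := hy (j + 1)
  have h4 := hy (j + 4)
  rw [add_assoc, show (2 + 3 : ZMod 7) = 5 by decide] at h1
  rw [add_assoc, show (5 + 3 : ZMod 7) = 1 by decide] at h2
  rw [add_assoc, show (1 + 3 : ZMod 7) = 4 by decide] at h3
  rw [add_assoc, show (4 + 3 : ZMod 7) = 0 by decide, add_zero] at h4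
  exact h5 _ _ _ _ _ h h1 h2 h3 h4

/-- Neighbours on a heptagon of the same vertex are equal or consecutive. -/
theorem IsHeptagon.sub_of_adj (h5 : NoClosedFiveWalk G) (hy : IsHeptagon G y) {v : V}
    {i j : ZMod 7} (hi : G.Adj v (y i)) (hj : G.Adj v (y j)) :
    j - i = 0 ∨ j - i = 1 ∨ j - i = 6 := by
  obtain ⟨d, rfl⟩ : ∃ d, j = i + d := ⟨j - i, by ring⟩
  rw [add_sub_cancel_left]
  have key : ∀ (i d : ZMod 7), (d = 2 ∨ d = 3) → G.Adj v (y i) → ¬ G.Adj v (y (i + d)) := by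
    rintro i d (rfl | rfl) hi hj
    · have h1 := hy i
      have h2 := hy (i + 3)
      have h3 := hy (i + 6)
      rw [add_assoc, show (3 + 3 : ZMod 7) = 6 by decide] at h2
      rw [add_assoc, show (6 + 3 : ZMod 7) = 2 by decide] at h3
      exact h5 _ _ _ _ _ hi h1 h2 h3 hj.symm
    · exact h5.triangle _ _ _ hi (hy i) hj.symm
  have h1 := fun h => key i d h hi hj
  have h2 := fun h => key (i + d) (-d) h hj (by simpa using hi)
  revert h1 h2
  generalize d = e
  revert e
  decide

/-- Neighbours on a heptagon of adjacent vertices are neither equal nor consecutive. -/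
theorem IsHeptagon.sub_of_adj_adj (h5 : NoClosedFiveWalk G) (hy : IsHeptagon G y) {u v : V}
    (huv : G.Adj u v) {i j : ZMod 7} (hi : G.Adj u (y i)) (hj : G.Adj v (y j)) :
    j - i ≠ 0 ∧ j - i ≠ 1 ∧ j - i ≠ 6 := by
  have key : ∀ (u v : V) (i : ZMod 7), G.Adj u v → G.Adj u (y i) → ¬ G.Adj v (y (i + 1)) := by
    intro u v i huv hi hj
    have h1 := hy (i + 1)
    rw [add_assoc, show (1 + 3 : ZMod 7) = 4 by decide] at h1
    exact h5 _ _ _ _ _ huv hj h1 (hy.adj_four i) hi.symm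
  refine ⟨fun h => ?_, fun h => ?_, fun h => ?_⟩
  · rw [sub_eq_zero.1 h] at hj
    exact h5.triangle _ _ _ huv hj hi.symm
  · rw [sub_eq_iff_eq_add'.1 h] at hj
    exact key u v i huv hi hj
  · rw [show i = j + 1 by rw [sub_eq_iff_eq_add'.1 h, add_assoc]; simp; decide] at hi
    exact key v u j huv.symm hj hi

/-- The edge `uv` and four heptagon vertices form a hexagon; its third possible chord, from `y i` to
`y (i + 2)`, would close a 5-walk. -/
theorem IsHeptagon.adj_or_adj (h5 : NoClosedFiveWalk G) (hhex : HexagonChord G)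
    (hy : IsHeptagon G y) {u v : V} (huv : G.Adj u v) {i : ZMod 7} (hi : G.Adj u (y i))
    (hj : G.Adj v (y (i + 2))) : G.Adj u (y (i - 1)) ∨ G.Adj v (y (i + 3)) := by
  have h1 := hy (i - 1)
  have h2 := hy (i + 2)
  have h3 := hy.adj_four (i - 1)
  rw [show i - 1 + 3 = i + 2 by ring] at h1
  rw [show i - 1 + 4 = i + 3 by ring] at h3
  rcases hhex (y (i - 1)) (y (i + 3)) (y i) u v (y (i + 2)) h3.symm (hy i).symm hi.symm huv hj
    h1.symm with h | h | h
  · exact Or.inl h.symm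
  · exact Or.inr h.symm
  · exact (hy.not_adj_two h5 i h).elim

/-- The vertices can be placed on a circle with fourteen points in such a way that adjacent
vertices are nearly opposite. -/
theorem exists_placement [Fintype V] (h5 : NoClosedFiveWalk G) (hd : DenseFifth G)
    (hs : FourWalkSaturated G) (hy : IsHeptagon G y) :
    ∃ s : V → Fin 14,
      (∀ u v, G.Adj u v → 5 ≤ ((s v : ℕ) + 14 - s u) % 14 ∧ ((s v : ℕ) + 14 - s u) % 14 ≤ 9) ∧
      ∀ a b c d, G.Adj a b → G.Adj b c → G.Adj c d → ((s d : ℕ) + 1) % 14 ≠ s a := by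
  classical
  have hhex := Refutation.hexagonChord h5 hd hs
  have hex : ∀ v, ∃ s : Fin 14, ∀ i : ZMod 7, G.Adj v (y i) ↔ Near s i := by
    intro v
    obtain ⟨j, hj⟩ := exists_adj_heptagon h5 hd hs hy v
    obtain ⟨s, h⟩ := exists_near (fun i => decide (G.Adj v (y i))) ⟨j, decide_eq_true hj⟩
      (fun i j hi hj => hy.sub_of_adj h5 (of_decide_eq_true hi) (of_decide_eq_true hj))
    exact ⟨s, fun i => decide_eq_true_iff.symm.trans (h i)⟩
  choose s hsv using hex
  have hcase : ∀ u v, G.Adj u v → ∀ i : Fin 7, Near (s u) i → Near (s v) (i + 2) →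
      Near (s u) (i - 1) ∨ Near (s v) (i + 3) := fun u v huv i hi hj =>
    (hy.adj_or_adj h5 hhex huv ((hsv u i).2 hi) ((hsv v _).2 hj)).imp
      (hsv u _).1 (hsv v _).1
  refine ⟨s, fun u v huv => near_edge _ _ (fun i j hi hj =>
    hy.sub_of_adj_adj h5 huv ((hsv u i).2 hi) ((hsv v j).2 hj)) (hcase u v huv)
    (hcase v u huv.symm), fun a b c d hab hbc hcd h => ?_⟩
  obtain ⟨i, hi, hj⟩ := near_succ _ _ h
  exact h5 _ _ _ _ _ hab hbc hcd ((hsv d i).2 hj) ((hsv a i).2 hi).symm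

end types

/-! ### Edge weights and short closed walks -/

section weights

variable {V : Type*} {G : SimpleGraph V}

/-- The deviation of an oriented edge from joining opposite points. -/
def deviation (s : V → Fin 14) (u v : V) : ℤ :=
  ((s v : ℕ) - (s u : ℕ) - 5 : ℤ) % 14 - 2

/-- The weight of an oriented edge for a given placement of the vertices on a circle. -/
def edgeWeight (s : V → Fin 14) (u v : V) : ℤ :=
  (deviation s u v - ((s v : ℕ) - (s u : ℕ) : ℤ)) / 7

theorem sum_periodic_shift {e : ℕ → ℤ} {ℓ : ℕ} (he : e ℓ = e 0) :
    ∑ i ∈ Finset.range ℓ, e (i + 1) = ∑ i ∈ Finset.range ℓ, e i := by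
  have h1 := Finset.sum_range_succ e ℓ
  have h2 := Finset.sum_range_succ' e ℓ
  linarith

theorem closed_walk_small (h5 : NoClosedFiveWalk G) {s : V → Fin 14}
    (hedge : ∀ u v, G.Adj u v →
      5 ≤ ((s v : ℕ) + 14 - s u) % 14 ∧ ((s v : ℕ) + 14 - s u) % 14 ≤ 9)
    (hthree : ∀ a b c d, G.Adj a b → G.Adj b c → G.Adj c d → ((s d : ℕ) + 1) % 14 ≠ s a)
    (hodd : ∀ u v, G.Adj u v → Odd (edgeWeight s u v))
    (ℓ : ℕ) (M : ℤ) (u : V) (hℓ : 0 < ℓ) (h10 : ℓ < 10)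
    (hw : WeightedWalk G (edgeWeight s) ℓ M u u) : 5 * M < ℓ := by
  have hpar := hw.odd_iff hodd
  obtain ⟨c, hper, hadj, hsum⟩ := hw.exists_periodic hℓ
  set e : ℕ → ℤ := fun i => deviation s (c i) (c (i + 1)) with he
  have heper : ∀ i, e (i + ℓ) = e i := by
    intro i
    simp only [he, hper, add_right_comm i ℓ 1]
  -- Position differences telescope round the closed walk.
  have hM : ∑ i ∈ Finset.range ℓ, e i = 7 * M := by
    have h1 : ∀ i, e i = 7 * edgeWeight s (c i) (c (i + 1)) +
        (((s (c (i + 1)) : ℕ) : ℤ) - ((s (c i) : ℕ) : ℤ)) := by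
      intro i
      have := hedge _ _ (hadj i)
      simp only [he, edgeWeight, deviation]
      omega
    rw [Finset.sum_congr rfl fun i _ => h1 i, Finset.sum_add_distrib, ← Finset.mul_sum, hsum,
      Finset.sum_range_sub (fun i => ((s (c i) : ℕ) : ℤ))]
    have := hper 0
    rw [zero_add] at this
    rw [this]
    ring
  -- Three deviations of 2 would give a displacement `3 * 7 + 6`, which is `-1` modulo 14 and
  -- excluded by `hthree`. Averaging gives `21 * M ≤ 5 * ℓ`; with parity only `ℓ = 5` could violate
  -- the claim.
  have hwin : ∀ i, e i + e (i + 1) + e (i + 2) ≤ 5 := by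
    intro i
    have h1 := hedge _ _ (hadj i)
    have h2 := hedge _ _ (hadj (i + 1))
    have h3 := hedge _ _ (hadj (i + 2))
    have h4 := hthree _ _ _ _ (hadj i) (hadj (i + 1)) (hadj (i + 2))
    simp only [he, deviation]
    simp only [add_assoc, Nat.reduceAdd] at *
    omega
  have h3 : 3 * (7 * M) ≤ ℓ * 5 := by
    have h1 := sum_periodic_shift (e := e) (ℓ := ℓ) (by simpa using heper 0)
    have h2 := sum_periodic_shift (e := fun i => e (i + 1)) (ℓ := ℓ)
      (by simpa [add_comm] using heper 1)
    have h := Finset.sum_le_card_nsmul (Finset.range ℓ)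
      (fun i => e i + e (i + 1) + e (i + 2)) 5 fun i _ => hwin i
    simp only [Finset.sum_add_distrib, Finset.card_range, nsmul_eq_mul] at h
    simp only [add_assoc, Nat.reduceAdd] at h1 h2 h
    linarith
  by_contra! hlt
  obtain rfl : ℓ = 5 := by
    have h1 : M = 1 ∨ M = 2 := by omega
    omega
  refine h5 _ _ _ _ _ (hadj 0) (hadj 1) (hadj 2) (hadj 3) ?_
  have := hadj 4
  rwa [show 4 + 1 = 0 + 5 by rfl, hper] at this

theorem nonempty_hom_of_isHeptagon [Fintype V] (h5 : NoClosedFiveWalk G) (hd : DenseFifth G)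
    (hs : FourWalkSaturated G) {y : ZMod 7 → V} (hy : IsHeptagon G y) :
    Nonempty (G →g andrasfaiF (Fintype.card V + 1)) := by
  obtain ⟨s, hedge, hthree⟩ := exists_placement h5 hd hs hy
  have hodd : ∀ u v, G.Adj u v → Odd (edgeWeight s u v) := by
    intro u v huv
    have := hedge u v huv
    rw [Int.odd_iff]
    simp only [edgeWeight, deviation]
    omega
  have hanti : ∀ u v, G.Adj u v → edgeWeight s v u = -edgeWeight s u v := by
    intro u v huv
    have := hedge u v huv
    simp only [edgeWeight, deviation]
    omega
  exact nonempty_hom_of_winding hodd hanti (winding_lt hd h5.triangle hodd hanti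
    (closed_walk_small h5 hedge hthree hodd))

end weights

/-! ### Maximal graphs are saturated -/

section saturation

variable {V : Type*} {G : SimpleGraph V}

theorem FourWalk.symm {u v : V} (h : FourWalk G u v) : FourWalk G v u := by
  obtain ⟨a, b, c, h1, h2, h3, h4⟩ := h
  exact ⟨c, b, a, h4.symm, h3.symm, h2.symm, h1.symm⟩

theorem two_steps {u v c d : V} (huv : ¬ G.Adj u v)
    (h1 : (G ⊔ SimpleGraph.edge u v).Adj v c) (h2 : (G ⊔ SimpleGraph.edge u v).Adj c d) :
    (∃ x, G.Adj v x ∧ G.Adj x d) ∨ G.Adj u d ∨ d = v := by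
  simp only [SimpleGraph.sup_adj, SimpleGraph.edge_adj] at h1 h2
  rcases h1 with h1 | ⟨⟨rfl, rfl⟩ | ⟨-, rfl⟩, h1'⟩
  · rcases h2 with h2 | ⟨⟨rfl, rfl⟩ | ⟨rfl, rfl⟩, -⟩
    · exact Or.inl ⟨_, h1, h2⟩
    · exact (huv h1.symm).elim
    · exact (G.loopless.irrefl _ h1).elim
  · exact (h1' rfl).elim
  · rcases h2 with h2 | ⟨⟨-, rfl⟩ | ⟨rfl, rfl⟩, h2'⟩
    · exact Or.inr (Or.inl h2)
    · exact Or.inr (Or.inr rfl)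
    · exact (h2' rfl).elim

/-- The other four edges may also be new, so the walk is cut at its midpoint `d`: by `two_steps`
each half lies in `G`, shortens to one edge, or is trivial. -/
theorem fourWalk_of_new_edge (h5 : NoClosedFiveWalk G) {u v c d e : V} (hne : u ≠ v)
    (huv : ¬ G.Adj u v) (h1 : (G ⊔ SimpleGraph.edge u v).Adj v c)
    (h2 : (G ⊔ SimpleGraph.edge u v).Adj c d) (h3 : (G ⊔ SimpleGraph.edge u v).Adj d e)
    (h4 : (G ⊔ SimpleGraph.edge u v).Adj e u) : FourWalk G u v := by
  have hv := two_steps huv h1 h2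
  rw [SimpleGraph.edge_comm] at h3 h4
  have hu := two_steps (fun h => huv h.symm) h4.symm h3.symm
  have h2w : ∀ x, G.Adj u x → G.Adj x v → FourWalk G u v := fun x hx hx' =>
    ⟨x, v, x, hx, hx', hx'.symm, hx'⟩
  rcases hv with ⟨x, hx, hx'⟩ | hv | rfl <;> rcases hu with ⟨z, hz, hz'⟩ | hu | rfl
  · exact ⟨z, d, x, hz, hz', hx'.symm, hx.symm⟩
  · exact (h5.triangle _ _ _ hx hx' hu.symm).elim
  · exact h2w x hx'.symm hx.symm
  · exact (h5.triangle _ _ _ hz hz' hv.symm).elim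
  · exact h2w d hv hu.symm
  · exact (G.loopless.irrefl _ hv).elim
  · exact h2w z hz hz'
  · exact (G.loopless.irrefl _ hu).elim
  · exact (hne rfl).elim

theorem DenseFifth.mono [Fintype V] {G' : SimpleGraph V} (h : G ≤ G') (hd : DenseFifth G) :
    DenseFifth G' := by
  classical
  intro v
  refine (hd v).trans_le (Nat.mul_le_mul_left 5 (Finset.card_le_card fun w hw => ?_))
  simp only [Finset.mem_filter, Finset.mem_univ, true_and] at hw ⊢
  exact h hw

theorem fourWalkSaturated_of_maximal [Fintype V] (hd : DenseFifth G)
    (hG : Maximal NoClosedFiveWalk G) : FourWalkSaturated G := by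
  intro u v huv
  by_cases hne : u = v
  · obtain ⟨w, hw⟩ := hd.exists_adj u
    subst hne
    exact ⟨w, u, w, hw, hw.symm, hw, hw.symm⟩
  have hnot : ¬ NoClosedFiveWalk (G ⊔ SimpleGraph.edge u v) := fun h =>
    huv (hG.le_of_ge h le_sup_left (by simp [SimpleGraph.edge_adj, hne]))
  have key : ∀ a b c d e, (G ⊔ SimpleGraph.edge u v).Adj a b →
      (G ⊔ SimpleGraph.edge u v).Adj b c → (G ⊔ SimpleGraph.edge u v).Adj c d →
      (G ⊔ SimpleGraph.edge u v).Adj d e → (G ⊔ SimpleGraph.edge u v).Adj e a →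
      G.Adj a b ∨ FourWalk G u v := by
    intro a b c d e h1 h2 h3 h4 h5
    rw [SimpleGraph.sup_adj, SimpleGraph.edge_adj] at h1
    rcases h1 with h1 | ⟨⟨rfl, rfl⟩ | ⟨rfl, rfl⟩, -⟩
    · exact Or.inl h1
    · exact Or.inr (fourWalk_of_new_edge hG.prop hne huv h2 h3 h4 h5)
    · rw [SimpleGraph.edge_comm] at h2 h3 h4 h5
      exact Or.inr (fourWalk_of_new_edge hG.prop (Ne.symm hne) (fun h => huv h.symm)
        h2 h3 h4 h5).symm
  by_contra hcon
  refine hnot fun a b c d e h1 h2 h3 h4 h5 => ?_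
  exact hG.prop a b c d e ((key a b c d e h1 h2 h3 h4 h5).resolve_right hcon)
    ((key b c d e a h2 h3 h4 h5 h1).resolve_right hcon)
    ((key c d e a b h3 h4 h5 h1 h2).resolve_right hcon)
    ((key d e a b c h4 h5 h1 h2 h3).resolve_right hcon)
    ((key e a b c d h5 h1 h2 h3 h4).resolve_right hcon)

end saturation

/-! ### Heptagons from odd closed walks; the bipartite case -/

section bipartite

variable {V : Type*} {G : SimpleGraph V}

theorem exists_isHeptagon {a b c d e f g : V} (h1 : G.Adj a b) (h2 : G.Adj b c) (h3 : G.Adj c d)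
    (h4 : G.Adj d e) (h5 : G.Adj e f) (h6 : G.Adj f g) (h7 : G.Adj g a) :
    ∃ y : ZMod 7 → V, IsHeptagon G y := by
  -- The walk visits the positions `0, 3, 6, 2, 5, 1, 4`.
  refine ⟨(![a, f, d, b, g, e, c] : Fin 7 → V), fun j => ?_⟩
  change Fin 7 at j
  fin_cases j
  exacts [h1, h6, h4, h2, h7, h5, h3]

open WeightedWalk in
/-- A shortest odd closed walk is a heptagon. -/
theorem exists_isHeptagon_of_odd (h5 : NoClosedFiveWalk G) (hs : FourWalkSaturated G)
    {m : V → V → ℤ} : ∀ (ℓ : ℕ) (M : ℤ) (u : V), ℓ % 2 = 1 → WeightedWalk G m ℓ M u u →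
      ∃ y : ZMod 7 → V, IsHeptagon G y := by
  intro ℓ
  induction ℓ using Nat.strong_induction_on with
  | _ ℓ ih =>
  intro M u hℓ hw
  obtain ⟨c, h0, hc, hadj, -⟩ := hw.exists_seq
  rcases Nat.lt_or_ge ℓ 9 with h9 | h9
  · obtain rfl | rfl | rfl | rfl : ℓ = 1 ∨ ℓ = 3 ∨ ℓ = 5 ∨ ℓ = 7 := by omega
    · have := hadj 0 (by omega)
      rw [zero_add, h0, hc] at this
      exact (G.loopless.irrefl _ this).elim
    · have := hadj 2 (by omega)
      rw [hc, ← h0] at this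
      exact (h5.triangle _ _ _ (hadj 0 (by omega)) (hadj 1 (by omega)) this).elim
    · have := hadj 4 (by omega)
      rw [hc, ← h0] at this
      exact (h5 _ _ _ _ _ (hadj 0 (by omega)) (hadj 1 (by omega)) (hadj 2 (by omega))
        (hadj 3 (by omega)) this).elim
    · have := hadj 6 (by omega)
      rw [hc, ← h0] at this
      exact exists_isHeptagon (hadj 0 (by omega)) (hadj 1 (by omega)) (hadj 2 (by omega))
        (hadj 3 (by omega)) (hadj 4 (by omega)) (hadj 5 (by omega)) this
  -- An edge from `c 0` to `c 3` shortens the walk by two; otherwise a four-walk between them closes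
  -- up with `c 0, …, c 3` to length seven.
  · by_cases h03 : G.Adj (c 0) (c 3)
    · have hseg := segment (m := m) (show 3 ≤ ℓ by omega) fun t _ ht => hadj t ht
      rw [hc, ← h0] at hseg
      exact ih _ (by omega) _ _ (by omega) ((single h03).trans hseg)
    · obtain ⟨p, q, r, k1, k2, k3, k4⟩ := hs _ _ h03
      exact exists_isHeptagon k1 k2 k3 k4 (hadj 2 (by omega)).symm (hadj 1 (by omega)).symm
        (hadj 0 (by omega)).symm

theorem exists_weightedWalk (m : V → V → ℤ) {u v : V} (p : G.Walk u v) :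
    ∃ M, WeightedWalk G m p.length M u v := by
  induction p with
  | nil => exact ⟨0, .nil _⟩
  | cons h p ih =>
    obtain ⟨M, hM⟩ := ih
    rw [SimpleGraph.Walk.length_cons, add_comm]
    exact ⟨_, (WeightedWalk.single h).trans hM⟩

theorem nonempty_hom_of_saturated [Fintype V] (h5 : NoClosedFiveWalk G) (hd : DenseFifth G)
    (hs : FourWalkSaturated G) : ∃ k : ℕ, 1 ≤ k ∧ Nonempty (G →g andrasfaiF k) := by
  by_cases hy : ∃ y : ZMod 7 → V, IsHeptagon G y
  · obtain ⟨y, hy⟩ := hy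
    exact ⟨_, Nat.le_add_left _ _, nonempty_hom_of_isHeptagon h5 hd hs hy⟩
  · have h2 : G.Colorable 2 := SimpleGraph.two_colorable_iff_forall_loop_even.2 fun u p => by
      by_contra hodd
      obtain ⟨M, hM⟩ := exists_weightedWalk 0 p
      exact hy (exists_isHeptagon_of_odd h5 hs _ _ _
        (Nat.odd_iff.1 (Nat.not_even_iff_odd.1 hodd)) hM)
    obtain ⟨f⟩ := h2
    have hadj : ∀ i j : Fin 2, i ≠ j → cyclicDist i j % 5 = 1 % 5 := by decide
    exact ⟨1, le_rfl, ⟨⟨fun v => f v, fun h => hadj _ _ (f.valid h)⟩⟩⟩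

end bipartite

/-! ### From the stated hypotheses to the working ones -/

section main

variable {V : Type*} {G : SimpleGraph V}

theorem no_triangle_of_free (hC3 : (SimpleGraph.cycleGraph 3).Free G) (a b c : V)
    (hab : G.Adj a b) (hbc : G.Adj b c) : ¬ G.Adj c a := by
  intro hca
  refine hC3 ⟨⟨⟨![a, b, c], ?_⟩, ?_⟩⟩
  · intro i j h
    rw [SimpleGraph.cycleGraph_adj] at h
    fin_cases i <;> fin_cases j <;> first
      | exact absurd h (by decide)
      | simp [hab, hbc, hca, hab.symm, hbc.symm, hca.symm]
  · intro i j h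
    have := hab.ne
    have := hbc.ne
    have := hca.ne
    fin_cases i <;> fin_cases j <;> simp_all

theorem noClosedFiveWalk_of_free (hC3 : (SimpleGraph.cycleGraph 3).Free G)
    (hC5 : (SimpleGraph.cycleGraph 5).Free G) : NoClosedFiveWalk G := by
  intro a b c d e hab hbc hcd hde hea
  have h3 := no_triangle_of_free hC3
  have hac : a ≠ c := by rintro rfl; exact h3 _ _ _ hcd hde hea
  have had : a ≠ d := by rintro rfl; exact h3 _ _ _ hab hbc hcd
  have hbd : b ≠ d := by rintro rfl; exact h3 _ _ _ hde hea hab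
  have hbe : b ≠ e := by rintro rfl; exact h3 _ _ _ hbc hcd hde
  have hce : c ≠ e := by rintro rfl; exact h3 _ _ _ hea hab hbc
  refine hC5 ⟨⟨⟨![a, b, c, d, e], ?_⟩, ?_⟩⟩
  · intro i j h
    rw [SimpleGraph.cycleGraph_adj] at h
    fin_cases i <;> fin_cases j <;> first
      | exact absurd h (by decide)
      | simp [hab, hbc, hcd, hde, hea, hab.symm, hbc.symm, hcd.symm, hde.symm, hea.symm]
  · have hinj : Function.Injective ![a, b, c, d, e] := by
      rw [← List.nodup_ofFn]
      simp [hab.ne, hac, had, hea.ne.symm, hbc.ne, hbd, hbe, hcd.ne, hce, hde.ne]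
    exact hinj

theorem denseFifth_of_minDegree [Fintype V] [DecidableRel G.Adj]
    (hdeg : (Fintype.card V : ℝ) / 5 < (G.minDegree : ℝ)) : DenseFifth G := by
  intro v
  have h1 : (Finset.univ.filter (G.Adj v)).card = G.degree v := by
    rw [← SimpleGraph.card_neighborFinset_eq_degree, SimpleGraph.neighborFinset_eq_filter]
  have h2 : (G.minDegree : ℝ) ≤ G.degree v := by exact_mod_cast G.minDegree_le_degree v
  have h3 : (Fintype.card V : ℝ) < 5 * G.degree v := by linarith
  have h4 : Fintype.card V < 5 * G.degree v := by exact_mod_cast h3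
  rw [← h1] at h4
  convert h4

end main

theorem mainTheorem1 {V : Type*} [Fintype V] (G : SimpleGraph V) [DecidableRel G.Adj]
    (hC3 : (SimpleGraph.cycleGraph 3).Free G) (hC5 : (SimpleGraph.cycleGraph 5).Free G)
    (hdeg : (Fintype.card V : ℝ) / 5 < (G.minDegree : ℝ)) :
    ∃ k : ℕ, 1 ≤ k ∧ Nonempty (G →g andrasfaiF k) := by
  classical
  obtain ⟨G', hle, hmax⟩ := Finite.exists_le_maximal (noClosedFiveWalk_of_free hC3 hC5)
  have hd := (denseFifth_of_minDegree hdeg).mono hle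
  obtain ⟨k, hk, ⟨f⟩⟩ := nonempty_hom_of_saturated hmax.prop hd
    (fourWalkSaturated_of_maximal hd hmax)
  exact ⟨k, hk, ⟨f.comp (SimpleGraph.Hom.ofLE hle)⟩⟩
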